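/- **Setting.** Let $\mathfrak S\subset\mathfrak P(X)$ be an *interval system*: for all $A,B\in\mathfrak S$ both $A\setminus B$ and $A\cap B$ are unions of countably many pairwise disjoint members of $\mathfrak S$ ("countable" includes finite and empty). Let $\mathcal W$ be a complete Hausdorff first countable (i.e. Fréchet) locally convex real topological vector space, and let $\mu:\mathfrak S\to\mathcal W$ be a *measure*: $\mu(A)=\sum_\lambda\mu(A_\lambda)$ (unconditional convergence) for every countable disjoint decomposition $A=\bigcup_\lambda A_\lambda$ with $A,A_\lambda\in\mathfrak S$. A *step-function* is a finite sum $\sum_{j\in J} c_j\chi_{E_j}$ with $c_j\in\mathbb R$, $E_j\in\mathfrak S$. An *envelope* is a set $\mathcal A\subset\mathbb R\times X$ which contains $\{(s(x),x):x\in X\}$ for some step-function $s$, and for which there is a countable $\mathfrak D\subset\mathfrak S$ with $\mathcal A=\bigcup_{D\in\mathfrak D}(\mathcal A^D\times D)\cup\bigl(\{0\}\times(X\setminus\bigcup\mathfrak D)\bigr)$, where $\mathcal A^D=\{y:(y,x)\in\mathcal A\ \forall x\in D\}$; it is *pointed* if it contains $\{0\}\times X$; it *approximates* $f:X\to\mathbb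 R$ if it contains all $(f(x),x)$. Let $\int^{\mathrm p}(\mathcal A,\mu)$ be the closure of the set of all $\sum_{j\in J}c_j\mu(E_j)$ with $J$ finite, $c_j\in\mathbb R$, $E_j\in\mathfrak S$ and $\sum_j c_j\chi_{E_j}$ approximated by $\mathcal A$. The function $f$ is *integrable* with integral $\int f\mu=a\in\mathcal W$ if for every neighbourhood $\mathcal T$ of $0$ there is an envelope $\mathcal A$ approximating $f$ with $\int^{\mathrm p}(\mathcal A,\mu)\subset a+\mathcal T$. A set $N\subset X$ is *negligible* if for every neighbourhood $\mathcal T$ of $0$ there is a pointed envelope $\mathcal C\supset\mathbb R\times N$ with $\int^{\mathrm p}(\mathcal C,\mu)\subset\mathcal T$. Let $\operatorname{svar}(f,\mu)$ be the closure of the set of all finite sums $\sum_{j\in J}\int f\chi_{A_j}\,\mu$, with pairwise disjoint $A_j\in\mathfrak S$ for which these integrals exist, and let $\operatorname{svar}(c,E,\mu)$ be the closure of the set of all finite sums $\sum_{j\in J}c\,\mu(A_j)$ with pairwise disjoint $A_j\in\mathfrak S$, $A_j\subset E$. For sets $S_\lambda\ni0$, $\sum_\lambda S_\lambda$ denotes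 the set of all sums $\sum_\lambda s_\lambda$ with $s_\lambda\in S_\lambda$ and only finitely many $s_\lambda\ne0$. **Theorem.** (a) If $f:X\to\mathbb R$ is integrable, then for every neighbourhood $\mathcal T$ of $0$ in $\mathcal W$ there are countable families $c_\lambda\in\mathbb R$, $E_\lambda\in\mathfrak S$ $(\lambda\in\Lambda)$ such that (i) $f(x)=\sum_{\lambda\in\Lambda}c_\lambda\chi_{E_\lambda}(x)$, with unconditional convergence, for all $x$ outside a negligible set; (ii) $\overline{\sum_{\lambda\in\Lambda}\operatorname{svar}(c_\lambda,E_\lambda,\mu)}\subset\operatorname{svar}(f,\mu)+\mathcal T$; (iii) for every neighbourhood $\mathcal T'$ of $0$ in $\mathcal W$ there is a finite $\Xi\subset\Lambda$ with $\overline{\sum_{\lambda\in\Lambda\setminus\Xi}\operatorname{svar}(c_\lambda,E_\lambda,\mu)}\subset\mathcal T'$. (b) If $\mathcal W=\mathbb R$ and $f$ is integrable, then for every $\varepsilon>0$ the families can be chosen so that (i), (iii), and (ii) with $\mathcal T=(-\varepsilon,\varepsilon)$ hold and, moreover, for every $x\in X$ either $f(x)=\sum_{\lambda}c_\lambda\chi_{E_\lambda}(x)$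 or this series is completely divergent at $x$, i.e. its positive terms and its negative terms both have infinite sum. -/

import Mathlib

open scoped Topology Pointwise

noncomputable section

namespace LMInt

universe u v

variable {X : Type u}

/-- Interval systems: `A \ B` and `A ∩ B` are countable disjoint unions of members of the system. -/
def IsIntervalSystem (S : Set (Set X)) : Prop :=
  ∀ A ∈ S, ∀ B ∈ S,
    (∃ C : Set (Set X), C ⊆ S ∧ C.Countable ∧ C.PairwiseDisjoint id ∧ A \ B = ⋃₀ C) ∧
    (∃ D : Set (Set X), D ⊆ S ∧ D.Countable ∧ D.PairwiseDisjoint id ∧ A ∩ B = ⋃₀ D)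

/-- The step-function `∑ j, c j • χ_(E j)`. -/
def stepFun {n : ℕ} (c : Fin n → ℝ) (E : Fin n → Set X) (x : X) : ℝ :=
  ∑ j, (E j).indicator (fun _ => c j) x

/-- The graph of `f`, with the value in the first coordinate, lies in `A`
(`A` approximates `f`). -/
def Approximates (A : Set (ℝ × X)) (f : X → ℝ) : Prop :=
  ∀ x, (f x, x) ∈ A

/-- `A^R`, the values `y` with `(y, x) ∈ A` for all `x ∈ R`. -/
def fiberOn (A : Set (ℝ × X)) (R : Set X) : Set ℝ :=
  {y | ∀ x ∈ R, (y, x) ∈ A}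

/-- `⟨𝔇⟩_A`, the union of all `A^D × D` with `D ∈ 𝔇`, and of `{0} × (X \ ⋃ 𝔇)`. -/
def generated (𝔇 : Set (Set X)) (A : Set (ℝ × X)) : Set (ℝ × X) :=
  (⋃ D ∈ 𝔇, fiberOn A D ×ˢ D) ∪ ({0} ×ˢ (⋃₀ 𝔇)ᶜ)

/-- Envelopes: sets containing the graph of a step-function and having a countable
generating system. -/
def IsEnvelope (S : Set (Set X)) (A : Set (ℝ × X)) : Prop :=
  (∃ (n : ℕ) (c : Fin n → ℝ) (E : Fin n → Set X),
      (∀ j, E j ∈ S) ∧ Approximates A (stepFun c E)) ∧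
  (∃ 𝔇 : Set (Set X), 𝔇 ⊆ S ∧ 𝔇.Countable ∧ A = generated 𝔇 A)

/-- Pointed envelopes: envelopes containing the graph of the zero function. -/
def IsPointedEnvelope (S : Set (Set X)) (C : Set (ℝ × X)) : Prop :=
  IsEnvelope S C ∧ Approximates C (fun _ => 0)

section vector

variable {W : Type v} [AddCommGroup W] [Module ℝ W] [TopologicalSpace W]

/-- `W`-valued measures on `S`: sigma-additivity with unconditional sums. Only the values of `μ`
on members of `S` matter. -/
def IsMeasureOn (S : Set (Set X)) (μ : Set X → W) : Prop :=
  ∀ (Λ : Type) [Countable Λ] (A : Set X) (B : Λ → Set X),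
    A ∈ S → (∀ l, B l ∈ S) → Pairwise (fun k l => Disjoint (B k) (B l)) → A = ⋃ l, B l →
      HasSum (fun l => μ (B l)) (μ A)

/-- The bilinear sum of an envelope: the closure of the set of pre-integrals of all
step-functions whose graph lies in `A`. -/
def bilinearSum (S : Set (Set X)) (μ : Set X → W) (A : Set (ℝ × X)) : Set W :=
  closure {w | ∃ (n : ℕ) (c : Fin n → ℝ) (E : Fin n → Set X),
    (∀ j, E j ∈ S) ∧ Approximates A (stepFun c E) ∧ w = ∑ j, c j • μ (E j)}

/-- `a` is the (Lebesgue-McShane) integral of `f`. -/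
def HasIntegral (S : Set (Set X)) (μ : Set X → W) (f : X → ℝ) (a : W) : Prop :=
  ∀ T ∈ 𝓝 (0 : W), ∃ A : Set (ℝ × X),
    IsEnvelope S A ∧ Approximates A f ∧ bilinearSum S μ A ⊆ {a} + T

def IsIntegrable (S : Set (Set X)) (μ : Set X → W) (f : X → ℝ) : Prop :=
  ∃ a, HasIntegral S μ f a

/-- The semivariation of the function `f`: the closure of the set of all finite sums of integrals
of `f` restricted to pairwise disjoint members of `S`. -/
def svar (S : Set (Set X)) (μ : Set X → W) (f : X → ℝ) : Set W :=
  closure {w | ∃ (n : ℕ) (A : Fin n → Set X) (a : Fin n → W),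
    (∀ j, A j ∈ S) ∧ Pairwise (fun i j => Disjoint (A i) (A j)) ∧
    (∀ j, HasIntegral S μ ((A j).indicator f) (a j)) ∧ w = ∑ j, a j}

/-- The semivariation of the set `E` with coefficient `c`. -/
def svarSet (S : Set (Set X)) (μ : Set X → W) (c : ℝ) (E : Set X) : Set W :=
  closure {w | ∃ (n : ℕ) (A : Fin n → Set X),
    (∀ j, A j ∈ S) ∧ (∀ j, A j ⊆ E) ∧ Pairwise (fun i j => Disjoint (A i) (A j)) ∧
    w = ∑ j, c • μ (A j)}

/-- Algebraic sum of a family of sets: sums of finitely supported selections. -/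
def algSum {Λ : Type} (A : Λ → Set W) : Set W :=
  {w | ∃ a : Λ →₀ W, (∀ l, a l ∈ A l) ∧ w = a.sum (fun _ v => v)}

/-- (Strongly) negligible sets. -/
def IsNegligible (S : Set (Set X)) (μ : Set X → W) (N : Set X) : Prop :=
  ∀ T ∈ 𝓝 (0 : W), ∃ C : Set (ℝ × X),
    IsPointedEnvelope S C ∧ Set.univ ×ˢ N ⊆ C ∧ bilinearSum S μ C ⊆ T

/-- The closure of the sum of the semivariations of the terms `c l • χ_(E l)` lies in `U`. -/
def SumSvarIn (S : Set (Set X)) (μ : Set X → W) {Λ : Type} (c : Λ → ℝ) (E : Λ → Set X)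
    (U : Set W) : Prop :=
  closure (algSum fun l => svarSet S μ (c l) (E l)) ⊆ U

/-- The tails of the sum of the semivariations become arbitrarily small. -/
def SvarTailsSmall (S : Set (Set X)) (μ : Set X → W) {Λ : Type} (c : Λ → ℝ)
    (E : Λ → Set X) : Prop :=
  ∀ T ∈ 𝓝 (0 : W), ∃ Ξ : Finset Λ,
    SumSvarIn S μ (fun l : {l // l ∉ Ξ} => c l) (fun l : {l // l ∉ Ξ} => E l) T

end vector

/-- The terms `c l • χ_(E l) x` have unconditional sum `f x`. -/
def SumsTo {Λ : Type} (c : Λ → ℝ) (E : Λ → Set X) (f : X → ℝ) (x : X) : Prop :=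
  HasSum (fun l => (E l).indicator (fun _ => c l) x) (f x)

/-- Complete divergence at `x`: the sum of the positive terms and the sum of the negative terms
are both infinite. -/
def CompletelyDivergent {Λ : Type} (c : Λ → ℝ) (E : Λ → Set X) (x : X) : Prop :=
  ¬ Summable (fun l => max ((E l).indicator (fun _ => c l) x) 0) ∧
  ¬ Summable (fun l => max (-(E l).indicator (fun _ => c l) x) 0)

end LMInt

end

open LMInt

/-! Integrability puts f into envelopes in which any two admissible choices of values differ, over
finite disjoint families, by arbitrarily small sums (`Small`). Take envelopes 𝒜 n whose differences
shrink along a `NhdChain`, and step-functions φ n in 𝒜 n such that φ (n + 1) lies in 𝒜 n as well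
(`EnvChain`). The series is φ 0 + ∑ (φ (n + 1) - φ n), each term being cut into countably many
disjoint pieces on which it is constant.

Since φ n and φ (n + 1) share 𝒜 n, the semivariation of their difference is controlled by 𝒜 n, and
the levels add up like a geometric series. The pieces of φ 0 are compared with integrals of f over
members of S, which exist by `Approximable.indicator` and `Approximable.isIntegrable`; this is (ii).
For (iii), finitely many levels have small tails by sigma-additivity, and the remaining levels are
small as a whole. For (i), the Borel-Cantelli lemma `isNegligible_of_not_summable` makes ∑ |φ (n +
1) - φ n| and ∑ |φ n - f| finite off a negligible set.

The main obstacle is to get φ (n + 1) into two envelopes. Common values exist on countably many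
pieces, but a step-function may be altered on finitely many only. `exists_splice` makes the change
on finitely many pieces, keeps the old step-function elsewhere and enlarges the envelope
accordingly, at the cost of a small tail. Throughout, `preInt_mem_of_loc` reduces closed conditions
on pre-integrals to finite families of small pieces.

For (b), the exceptional set is covered infinitely often by sets of small total semivariation, each
entering once with coefficient 1 and once with -1. These terms cancel where the cover is finite and
diverge completely elsewhere. -/

namespace LMInt

/-! ### Countable covers, disjoint refinements and countably local properties -/

section Covers

variable {X : Type*} {S : Set (Set X)}

/-- `U` is the union of a countable disjoint subfamily of `S`. -/
def IsSigma (S : Set (Set X)) (U : Set X) : Prop :=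
  ∃ C : Set (Set X), C ⊆ S ∧ C.Countable ∧ C.PairwiseDisjoint id ∧ U = ⋃₀ C

theorem IsSigma.of_mem {A : Set X} (hA : A ∈ S) : IsSigma S A :=
  ⟨{A}, by simpa using hA, Set.countable_singleton A, Set.pairwiseDisjoint_singleton _ _, by simp⟩

theorem IsSigma.iUnion {ι : Type*} [Countable ι] {U : ι → Set X} (hU : ∀ i, IsSigma S (U i))
    (hd : Pairwise fun i j => Disjoint (U i) (U j)) : IsSigma S (⋃ i, U i) := by
  choose C hCS hCc hCd hC using hU
  refine ⟨⋃ i, C i, Set.iUnion_subset hCS, Set.countable_iUnion hCc, ?_, ?_⟩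
  · intro a ha b hb hab
    obtain ⟨i, hi⟩ := Set.mem_iUnion.1 ha
    obtain ⟨j, hj⟩ := Set.mem_iUnion.1 hb
    by_cases hij : i = j
    · subst hij
      exact hCd i hi hj hab
    · refine (hd hij).mono ?_ ?_
      · rw [hC i]; exact Set.subset_sUnion_of_mem hi
      · rw [hC j]; exact Set.subset_sUnion_of_mem hj
  · ext x
    simp only [hC, Set.mem_iUnion, Set.mem_sUnion]
    constructor
    · rintro ⟨i, t, ht, hx⟩; exact ⟨t, ⟨i, ht⟩, hx⟩
    · rintro ⟨t, ⟨i, ht⟩, hx⟩; exact ⟨i, t, ht, hx⟩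

theorem IsSigma.diff (hS : IsIntervalSystem S) {U E : Set X} (hU : IsSigma S U) (hE : E ∈ S) :
    IsSigma S (U \ E) := by
  obtain ⟨C, hCS, hCc, hCd, rfl⟩ := hU
  have : Countable C := hCc.to_subtype
  have h : ⋃₀ C \ E = ⋃ G : C, (G : Set X) \ E := by
    rw [Set.sUnion_eq_iUnion, Set.iUnion_sdiff]
  rw [h]
  refine IsSigma.iUnion (fun G => (hS G (hCS G.2) E hE).1) fun G G' hne => ?_
  exact (hCd G.2 G'.2 fun h => hne (Subtype.ext h)).mono Set.sdiff_subset Set.sdiff_subset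

theorem IsSigma.diff_biUnion (hS : IsIntervalSystem S) {ι : Type*} (J : Finset ι) {B : ι → Set X}
    (hB : ∀ i ∈ J, B i ∈ S) {U : Set X} (hU : IsSigma S U) : IsSigma S (U \ ⋃ i ∈ J, B i) := by
  classical
  induction J using Finset.induction_on with
  | empty => simpa using hU
  | insert a J _ ih =>
    have := (ih fun i hi => hB i (Finset.mem_insert_of_mem hi)).diff hS
      (hB a (Finset.mem_insert_self a J))
    rw [Finset.set_biUnion_insert, Set.union_comm, ← Set.sdiff_sdiff]
    exact this

/-- A countable subfamily of an interval system has a disjoint refinement with the same union. -/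
theorem exists_disjoint_refinement (hS : IsIntervalSystem S) {C : Set (Set X)} (hCS : C ⊆ S)
    (hC : C.Countable) :
    ∃ (Λ : Type) (_ : Countable Λ) (B : Λ → Set X), (∀ l, B l ∈ S) ∧ (∀ l, (B l).Nonempty) ∧
      Pairwise (fun k l => Disjoint (B k) (B l)) ∧ ⋃ l, B l = ⋃₀ C ∧
      ∀ l, ∃ G ∈ C, B l ⊆ G := by
  rcases C.eq_empty_or_nonempty with rfl | hne
  · exact ⟨Empty, inferInstance, fun l => l.elim, fun l => l.elim, fun l => l.elim,
      fun l => l.elim, by simp, fun l => l.elim⟩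
  obtain ⟨f, rfl⟩ := hC.exists_eq_range hne
  have hfS : ∀ n, f n ∈ S := fun n => hCS ⟨n, rfl⟩
  have hsig : ∀ n, IsSigma S (disjointed f n) := fun n =>
    disjointedRec (fun t i ht => ht.diff hS (hfS i)) (IsSigma.of_mem (hfS n))
  choose D hDS hDc hDd hD using hsig
  -- Empty pieces are dropped so that constant values can later be read off at a point; indexing by
  -- a subset of ℕ puts the index type into `Type`.
  let Λ' := Σ n : ℕ, {G : D n // (G : Set X).Nonempty}
  have : ∀ n, Countable (D n) := fun n => (hDc n).to_subtype
  obtain ⟨e, he⟩ := exists_injective_nat Λ'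
  let σ := Equiv.ofInjective e he
  let B : Set.range e → Set X := fun l => ((σ.symm l).2.1 : Set X)
  have hsub : ∀ l, B l ⊆ disjointed f (σ.symm l).1 := fun l => by
    rw [hD]; exact Set.subset_sUnion_of_mem (σ.symm l).2.1.2
  refine ⟨Set.range e, inferInstance, B, fun l => hDS _ (σ.symm l).2.1.2,
    fun l => (σ.symm l).2.2, ?_, ?_, fun l => ⟨f (σ.symm l).1, ⟨_, rfl⟩,
      (hsub l).trans (disjointed_subset _ _)⟩⟩
  · intro k l hkl
    by_cases h1 : (σ.symm k).1 = (σ.symm l).1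
    · have hne : σ.symm k ≠ σ.symm l := fun h => hkl (σ.symm.injective h)
      change Disjoint ((σ.symm k).2.1 : Set X) ((σ.symm l).2.1 : Set X)
      generalize σ.symm k = p at *
      generalize σ.symm l = q at *
      obtain ⟨n, P, hP⟩ := p
      obtain ⟨m, Q, hQ⟩ := q
      dsimp only at h1
      subst h1
      exact hDd n P.2 Q.2 fun h => hne (by
        have : P = Q := Subtype.ext h
        subst this; rfl)
    · exact (disjoint_disjointed f h1).mono (hsub k) (hsub l)
  · rw [Set.sUnion_range, ← iUnion_disjointed (f := f)]
    apply Set.Subset.antisymm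
    · exact Set.iUnion_subset fun l => (hsub l).trans (Set.subset_iUnion _ _)
    · intro x hx
      obtain ⟨n, hn⟩ := Set.mem_iUnion.1 hx
      obtain ⟨G, hG, hxG⟩ : ∃ G ∈ D n, x ∈ G := by rw [hD] at hn; exact hn
      refine Set.mem_iUnion.2 ⟨σ ⟨n, ⟨⟨G, hG⟩, ⟨x, hxG⟩⟩⟩, ?_⟩
      have hs := σ.symm_apply_apply ⟨n, ⟨⟨G, hG⟩, ⟨x, hxG⟩⟩⟩
      change x ∈ ((σ.symm _).2.1 : Set X)
      rw [hs]
      exact hxG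

/-- Intersections of members split into countably many members, so two countable families have a
common countable refinement of their overlaps. This is what makes local properties stable under
conjunction. -/
theorem exists_inter_family (hS : IsIntervalSystem S) {C D : Set (Set X)} (hCS : C ⊆ S)
    (hDS : D ⊆ S) (hC : C.Countable) (hD : D.Countable) :
    ∃ F ⊆ S, F.Countable ∧ (∀ G ∈ F, ∃ G' ∈ C, G ⊆ G') ∧ (∀ G ∈ F, ∃ G' ∈ D, G ⊆ G') ∧
      ∀ x, ∀ G ∈ C, ∀ G' ∈ D, x ∈ G → x ∈ G' → ∃ H ∈ F, x ∈ H ∧ H ⊆ G ∧ H ⊆ G' := by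
  have key : ∀ G : C, ∀ G' : D, IsSigma S ((G : Set X) ∩ G') := fun G G' =>
    (hS G (hCS G.2) G' (hDS G'.2)).2
  choose F hFS hFc _ hF using key
  have : Countable C := hC.to_subtype
  have : Countable D := hD.to_subtype
  have hsub : ∀ G G', ∀ H ∈ F G G', H ⊆ (G : Set X) ∩ G' := fun G G' H hH => by
    rw [hF]; exact Set.subset_sUnion_of_mem hH
  refine ⟨⋃ G, ⋃ G', F G G', Set.iUnion_subset fun G => Set.iUnion_subset fun G' => hFS G G',
    Set.countable_iUnion fun G => Set.countable_iUnion fun G' => hFc G G', ?_, ?_, ?_⟩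
  · intro H hH
    simp only [Set.mem_iUnion] at hH
    obtain ⟨G, G', hH⟩ := hH
    exact ⟨G, G.2, (hsub G G' H hH).trans Set.inter_subset_left⟩
  · intro H hH
    simp only [Set.mem_iUnion] at hH
    obtain ⟨G, G', hH⟩ := hH
    exact ⟨G', G'.2, (hsub G G' H hH).trans Set.inter_subset_right⟩
  · intro x G hG G' hG' hx hx'
    have hxx : x ∈ ⋃₀ F ⟨G, hG⟩ ⟨G', hG'⟩ := by rw [← hF]; exact ⟨hx, hx'⟩
    obtain ⟨H, hH, hxH⟩ := hxx
    refine ⟨H, Set.mem_iUnion.2 ⟨_, Set.mem_iUnion.2 ⟨_, hH⟩⟩, hxH, ?_, ?_⟩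
    · exact (hsub _ _ H hH).trans Set.inter_subset_left
    · exact (hsub _ _ H hH).trans Set.inter_subset_right

/-- On each member of `S`, countably many members of `S` suffice to find, whenever `P y x`,
a neighbourhood `G` of `x` with `R y G`. -/
def Loc {Y : Type*} (S : Set (Set X)) (P : Y → X → Prop) (R : Y → Set X → Prop) : Prop :=
  ∀ E ∈ S, ∃ C ⊆ S, C.Countable ∧ ∀ x ∈ E, ∀ y, P y x → ∃ G ∈ C, x ∈ G ∧ R y G

/-- Predicates that pass to subsets. -/
def Hered {Y : Type*} (R : Y → Set X → Prop) : Prop :=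
  ∀ y G H, H ⊆ G → R y G → R y H

variable {Y : Type*} {P P' : Y → X → Prop} {R R' : Y → Set X → Prop}

theorem Loc.map {Z : Type*} {P' : Z → X → Prop} {R' : Z → Set X → Prop} (h : Loc S P R)
    (hm : ∀ z x, P' z x → ∃ y, P y x ∧ ∀ G, x ∈ G → R y G → R' z G) : Loc S P' R' := by
  intro E hE
  obtain ⟨C, hCS, hC, h⟩ := h E hE
  refine ⟨C, hCS, hC, fun x hx z hz => ?_⟩
  obtain ⟨y, hy, hr⟩ := hm z x hz
  obtain ⟨G, hG, hxG, hRG⟩ := h x hx y hy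
  exact ⟨G, hG, hxG, hr G hxG hRG⟩

theorem Loc.mono (h : Loc S P R) (hP : ∀ y x, P' y x → P y x)
    (hR : ∀ y x G, P' y x → x ∈ G → R y G → R' y G) : Loc S P' R' :=
  h.map fun y x hy => ⟨y, hP y x hy, fun G hxG hG => hR y x G hy hxG hG⟩

theorem Loc.comap {Z : Type*} (h : Loc S P R) (g : Z → Y) :
    Loc S (fun z x => P (g z) x) (fun z G => R (g z) G) :=
  h.map fun z _ hz => ⟨g z, hz, fun _ _ hG => hG⟩

theorem Loc.and (hS : IsIntervalSystem S) (h : Loc S P R) (h' : Loc S P' R') (hR : Hered R)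
    (hR' : Hered R') :
    Loc S (fun y x => P y x ∧ P' y x) (fun y G => R y G ∧ R' y G) := by
  intro E hE
  obtain ⟨C, hCS, hC, h⟩ := h E hE
  obtain ⟨D, hDS, hD, h'⟩ := h' E hE
  obtain ⟨F, hFS, hF, -, -, hF'⟩ := exists_inter_family hS hCS hDS hC hD
  refine ⟨F, hFS, hF, fun x hx y hy => ?_⟩
  obtain ⟨G, hG, hxG, hr⟩ := h x hx y hy.1
  obtain ⟨G', hG', hxG', hr'⟩ := h' x hx y hy.2
  obtain ⟨H, hH, hxH, hHG, hHG'⟩ := hF' x G hG G' hG' hxG hxG'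
  exact ⟨H, hH, hxH, hR _ _ _ hHG hr, hR' _ _ _ hHG' hr'⟩

theorem Loc.or (h : Loc S P R) (h' : Loc S P' R') :
    Loc S (fun y x => P y x ∨ P' y x) (fun y G => R y G ∨ R' y G) := by
  intro E hE
  obtain ⟨C, hCS, hC, h⟩ := h E hE
  obtain ⟨D, hDS, hD, h'⟩ := h' E hE
  refine ⟨C ∪ D, Set.union_subset hCS hDS, hC.union hD, fun x hx y hy => ?_⟩
  rcases hy with hy | hy
  · obtain ⟨G, hG, hxG, hr⟩ := h x hx y hy
    exact ⟨G, Or.inl hG, hxG, Or.inl hr⟩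
  · obtain ⟨G, hG, hxG, hr⟩ := h' x hx y hy
    exact ⟨G, Or.inr hG, hxG, Or.inr hr⟩

theorem Loc.exists {ι : Type*} [Countable ι] {P : ι → Y → X → Prop} (h : ∀ i, Loc S (P i) R) :
    Loc S (fun y x => ∃ i, P i y x) R := by
  intro E hE
  choose C hCS hC h using fun i => h i E hE
  refine ⟨⋃ i, C i, Set.iUnion_subset hCS, Set.countable_iUnion hC, fun x hx y ⟨i, hy⟩ => ?_⟩
  obtain ⟨G, hG, hr⟩ := h i x hx y hy
  exact ⟨G, Set.mem_iUnion.2 ⟨i, hG⟩, hr⟩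

/-- Forgetting the value turns a property of pairs into one of points, the form needed by
`Loc.exists_partition`. -/
theorem Loc.exists_value (h : Loc S P R) {p : X → Prop} (hp : ∀ x, p x → ∃ y, P y x) :
    Loc S (fun (_ : Unit) x => p x) (fun _ G => ∃ y, R y G) :=
  h.map fun _ x hx => (hp x hx).imp fun y hy => ⟨hy, fun _ _ hG => ⟨y, hG⟩⟩

theorem Loc.of_countable (C : Set (Set X)) (hCS : C ⊆ S) (hC : C.Countable)
    (h : ∀ x y, P y x → ∃ G ∈ C, x ∈ G ∧ R y G) : Loc S P R :=
  fun _ _ => ⟨C, hCS, hC, fun x _ y hy => h x y hy⟩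

theorem Loc.of_forall (h : ∀ y G, R y G) : Loc S P R :=
  fun E hE => ⟨{E}, by simpa using hE, Set.countable_singleton E,
    fun _ hx y _ => ⟨E, rfl, hx, h y E⟩⟩

theorem Loc.cover (h : Loc S P R) {𝒱 : Set (Set X)} (h𝒱S : 𝒱 ⊆ S) (h𝒱 : 𝒱.Countable) :
    ∃ C ⊆ S, C.Countable ∧ ∀ x ∈ ⋃₀ 𝒱, ∀ y, P y x → ∃ G ∈ C, x ∈ G ∧ R y G := by
  choose C hCS hC h using fun E : 𝒱 => h E (h𝒱S E.2)
  have : Countable 𝒱 := h𝒱.to_subtype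
  refine ⟨⋃ i, C i, Set.iUnion_subset hCS, Set.countable_iUnion hC, fun x ⟨E, hE, hx⟩ y hy => ?_⟩
  obtain ⟨G, hG, hr⟩ := h ⟨E, hE⟩ x hx y hy
  exact ⟨G, Set.mem_iUnion.2 ⟨_, hG⟩, hr⟩

/-- Members of a countable family at which a local hereditary property holds can be covered by
a countable disjoint family of sets with this property. -/
theorem Loc.exists_partition (hS : IsIntervalSystem S) {Q : Set X → Prop}
    (hQ : ∀ G H, H ⊆ G → Q G → Q H) {p : X → Prop}
    (h : Loc S (fun (_ : Unit) x => p x) (fun _ G => Q G)) {𝒱 : Set (Set X)} (h𝒱S : 𝒱 ⊆ S)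
    (h𝒱 : 𝒱.Countable) (hp : ∀ x ∈ ⋃₀ 𝒱, p x) :
    ∃ (Λ : Type) (_ : Countable Λ) (B : Λ → Set X), (∀ l, B l ∈ S) ∧ (∀ l, (B l).Nonempty) ∧
      Pairwise (fun k l => Disjoint (B k) (B l)) ∧ ⋃₀ 𝒱 ⊆ ⋃ l, B l ∧ ∀ l, Q (B l) := by
  obtain ⟨C, hCS, hC, h⟩ := h.cover h𝒱S h𝒱
  obtain ⟨Λ, hΛ, B, hBS, hBne, hBd, hBU, hBC⟩ :=
    exists_disjoint_refinement hS (C := {G ∈ C | Q G}) (fun G hG => hCS hG.1)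
      (hC.mono fun G hG => hG.1)
  refine ⟨Λ, hΛ, B, hBS, hBne, hBd, ?_, fun l => ?_⟩
  · intro x hx
    obtain ⟨G, hG, hxG, hq⟩ := h x hx () (hp x hx)
    rw [hBU]
    exact ⟨G, ⟨hG, hq⟩, hxG⟩
  · obtain ⟨G, hG, hsub⟩ := hBC l
    exact hQ _ _ hsub hG.2

/-- `G` lies in `E` or in its complement. -/
def Decides (E G : Set X) : Prop := G ⊆ E ∨ Disjoint G E

theorem Decides.subset {E G : Set X} (h : Decides E G) {x : X} (hx : x ∈ G) (hx' : x ∈ E) :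
    G ⊆ E :=
  h.resolve_right fun hd => Set.disjoint_left.1 hd hx hx'

theorem Decides.disjoint {E G : Set X} (h : Decides E G) {x : X} (hx : x ∈ G) (hx' : x ∉ E) :
    Disjoint G E :=
  h.resolve_left fun hd => hx' (hd hx)

theorem Decides.anti {E G H : Set X} (hH : H ⊆ G) (h : Decides E G) : Decides E H :=
  h.imp (fun h => hH.trans h) fun h => h.mono_left hH

theorem loc_decides (hS : IsIntervalSystem S) {E : Set X} (hE : E ∈ S) :
    Loc S (fun (_ : Y) _ => True) (fun _ G => Decides E G) := by
  intro A hA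
  obtain ⟨⟨C, hCS, hC, -, hC'⟩, ⟨D, hDS, hD, -, hD'⟩⟩ := hS A hA E hE
  refine ⟨C ∪ D, Set.union_subset hCS hDS, hC.union hD, fun x hx y _ => ?_⟩
  by_cases hxE : x ∈ E
  · have : x ∈ ⋃₀ D := hD' ▸ ⟨hx, hxE⟩
    obtain ⟨G, hG, hxG⟩ := this
    refine ⟨G, Or.inr hG, hxG, Or.inl fun z hz => ?_⟩
    have : z ∈ A ∩ E := hD' ▸ ⟨G, hG, hz⟩
    exact this.2
  · have : x ∈ ⋃₀ C := hC' ▸ ⟨hx, hxE⟩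
    obtain ⟨G, hG, hxG⟩ := this
    refine ⟨G, Or.inl hG, hxG, Or.inr (Set.disjoint_left.2 fun z hz => ?_)⟩
    have : z ∈ A \ E := hC' ▸ ⟨G, hG, hz⟩
    exact this.2

theorem loc_forall_finset {ι : Type*} (hS : IsIntervalSystem S) (J : Finset ι)
    {P : ι → Y → X → Prop} {R : ι → Y → Set X → Prop} (hR : ∀ i ∈ J, Hered (R i))
    (h : ∀ i ∈ J, Loc S (P i) (R i)) :
    Loc S (fun y x => ∀ i ∈ J, P i y x) (fun y G => ∀ i ∈ J, R i y G) := by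
  classical
  induction J using Finset.induction_on with
  | empty => exact Loc.of_forall fun y G i hi => absurd hi (Finset.notMem_empty i)
  | insert a J _ ih =>
    refine (Loc.and hS (h a (Finset.mem_insert_self a J))
      (ih (fun i hi => hR i (Finset.mem_insert_of_mem hi))
        fun i hi => h i (Finset.mem_insert_of_mem hi)) (hR a (Finset.mem_insert_self a J)) ?_).mono
      ?_ ?_
    · intro y G H hHG hG i hi
      exact hR i (Finset.mem_insert_of_mem hi) y G H hHG (hG i hi)
    · intro y x hy
      exact ⟨hy a (Finset.mem_insert_self a J), fun i hi => hy i (Finset.mem_insert_of_mem hi)⟩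
    · intro y x G _ _ hG i hi
      rcases Finset.mem_insert.1 hi with rfl | hi
      · exact hG.1
      · exact hG.2 i hi

theorem loc_decides_finset {ι : Type*} (hS : IsIntervalSystem S) (J : Finset ι) {E : ι → Set X}
    (hE : ∀ i ∈ J, E i ∈ S) :
    Loc S (fun (_ : Y) _ => True) (fun _ G => ∀ i ∈ J, Decides (E i) G) :=
  (loc_forall_finset hS J (R := fun i _ G => Decides (E i) G)
    (fun _ _ _ _ _ hHG hG => hG.anti hHG) fun i hi => loc_decides hS (hE i hi)).mono
    (fun _ _ _ _ _ => trivial) fun _ _ _ _ _ h => h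

end Covers

/-! ### Step-functions as finitely supported coefficients -/

section Step

variable {X : Type*} {S : Set (Set X)}

/-- The step-function with coefficients `φ`. -/
noncomputable def stepVal : (Set X →₀ ℝ) →ₗ[ℝ] X → ℝ :=
  Finsupp.linearCombination ℝ fun E : Set X => E.indicator (1 : X → ℝ)

/-- The pre-integral of the step-function with coefficients `φ`. -/
noncomputable def preInt {W : Type*} [AddCommGroup W] [Module ℝ W] (μ : Set X → W) : (Set X →₀ ℝ) →ₗ[ℝ] W :=
  Finsupp.linearCombination ℝ μ

theorem stepVal_apply (φ : Set X →₀ ℝ) (x : X) :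
    stepVal φ x = ∑ E ∈ φ.support, φ E * E.indicator (1 : X → ℝ) x := by
  simp [stepVal, Finsupp.linearCombination_apply, Finsupp.sum, Finset.sum_apply]

theorem stepVal_single (E : Set X) (c : ℝ) (x : X) :
    stepVal (Finsupp.single E c) x = E.indicator (fun _ => c) x := by
  by_cases hx : x ∈ E <;> simp [stepVal, hx]

theorem preInt_apply {W : Type*} [AddCommGroup W] [Module ℝ W] (μ : Set X → W) (φ : Set X →₀ ℝ) :
    preInt μ φ = ∑ E ∈ φ.support, φ E • μ E := by
  simp [preInt, Finsupp.linearCombination_apply, Finsupp.sum]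

theorem preInt_single {W : Type*} [AddCommGroup W] [Module ℝ W] (μ : Set X → W) (E : Set X)
    (c : ℝ) : preInt μ (Finsupp.single E c) = c • μ E := by
  simp [preInt]

theorem preInt_sum_single {W : Type*} [AddCommGroup W] [Module ℝ W] (μ : Set X → W) {ι : Type*}
    (J : Finset ι) (A : ι → Set X) (e : ι → ℝ) :
    preInt μ (∑ i ∈ J, Finsupp.single (A i) (e i)) = ∑ i ∈ J, e i • μ (A i) := by
  simp [preInt_single]

theorem sum_single_mem_supported {ι : Type*} {J : Finset ι} {A : ι → Set X}
    (hA : ∀ i ∈ J, A i ∈ S) (e : ι → ℝ) :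
    ∑ i ∈ J, Finsupp.single (A i) (e i) ∈ Finsupp.supported ℝ ℝ S :=
  Submodule.sum_mem _ fun i hi => Finsupp.single_mem_supported ℝ _ (hA i hi)

theorem mem_of_mem_support_sum_single {ι : Type*} {J : Finset ι} {A : ι → Set X} {e : ι → ℝ}
    {E : Set X} (hE : E ∈ (∑ i ∈ J, Finsupp.single (A i) (e i)).support) : ∃ i ∈ J, E = A i := by
  have h : ∑ i ∈ J, Finsupp.single (A i) (e i) ∈ Finsupp.supported ℝ ℝ (A '' J) :=
    sum_single_mem_supported (fun i hi => Set.mem_image_of_mem A hi) e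
  obtain ⟨i, hi, rfl⟩ := (Finsupp.mem_supported ℝ _).1 h hE
  exact ⟨i, hi, rfl⟩

theorem stepVal_sum_single_apply {ι : Type*} (J : Finset ι) (A : ι → Set X) (e : ι → ℝ) (x : X) :
    stepVal (∑ i ∈ J, Finsupp.single (A i) (e i)) x
      = ∑ i ∈ J, (A i).indicator (fun _ => e i) x := by
  simp [map_sum, Finset.sum_apply, stepVal_single]

theorem stepVal_sum_single_of_mem {ι : Type*} {J : Finset ι} {A : ι → Set X}
    (hd : (J : Set ι).PairwiseDisjoint A) (e : ι → ℝ) {i : ι} (hi : i ∈ J) {x : X}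
    (hx : x ∈ A i) : stepVal (∑ i ∈ J, Finsupp.single (A i) (e i)) x = e i := by
  rw [stepVal_sum_single_apply, Finset.sum_eq_single_of_mem i hi]
  · simp [hx]
  · intro j hj hji
    exact Set.indicator_of_notMem (fun hxj => Set.disjoint_left.1 (hd hj hi hji) hxj hx) _

theorem stepVal_sum_single_of_notMem {ι : Type*} {J : Finset ι} {A : ι → Set X} (e : ι → ℝ)
    {x : X} (hx : ∀ i ∈ J, x ∉ A i) :
    stepVal (∑ i ∈ J, Finsupp.single (A i) (e i)) x = 0 := by
  rw [stepVal_sum_single_apply]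
  exact Finset.sum_eq_zero fun i hi => Set.indicator_of_notMem (hx i hi) _

/-- `G` lies in or is disjoint from every set used by `φ`. -/
def Resolves (φ : Set X →₀ ℝ) (G : Set X) : Prop := ∀ E ∈ φ.support, Decides E G

theorem Resolves.anti {φ : Set X →₀ ℝ} {G H : Set X} (hH : H ⊆ G) (h : Resolves φ G) :
    Resolves φ H := fun E hE => (h E hE).anti hH

theorem Resolves.eq {φ : Set X →₀ ℝ} {G : Set X} (h : Resolves φ G) {x y : X} (hx : x ∈ G)
    (hy : y ∈ G) : stepVal φ x = stepVal φ y := by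
  rw [stepVal_apply, stepVal_apply]
  refine Finset.sum_congr rfl fun E hE => ?_
  by_cases hxE : x ∈ E
  · simp [hxE, (h E hE).subset hx hxE hy]
  · simp [hxE, Set.disjoint_left.1 ((h E hE).disjoint hx hxE) hy]

theorem stepVal_eq_zero {φ : Set X →₀ ℝ} {x : X} (h : ∀ E ∈ φ.support, x ∉ E) :
    stepVal φ x = 0 := by
  rw [stepVal_apply]
  exact Finset.sum_eq_zero fun E hE => by simp [h E hE]

theorem stepVal_eq_sum_subset {φ : Set X →₀ ℝ} {G : Set X} (h : Resolves φ G) {x : X}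
    (hx : x ∈ G) : stepVal φ x = ∑ E ∈ φ.support, {E | G ⊆ E}.indicator φ E := by
  rw [stepVal_apply]
  refine Finset.sum_congr rfl fun E hE => ?_
  by_cases hxE : x ∈ E
  · have : G ⊆ E := (h E hE).subset hx hxE
    simp [hxE, this]
  · have : ¬ G ⊆ E := fun hs => hxE (hs hx)
    simp [hxE, this]

theorem loc_resolves {Y : Type*} (hS : IsIntervalSystem S) {φ : Set X →₀ ℝ}
    (hφ : φ ∈ Finsupp.supported ℝ ℝ S) :
    Loc S (fun (_ : Y) _ => True) (fun _ G => Resolves φ G) :=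
  loc_decides_finset hS φ.support (E := id) fun _ hE => (Finsupp.mem_supported ℝ φ).1 hφ hE

theorem stepFun_eq_stepVal {n : ℕ} (c : Fin n → ℝ) (E : Fin n → Set X) :
    stepFun c E = stepVal (∑ j, Finsupp.single (E j) (c j)) := by
  ext x
  rw [stepVal_sum_single_apply]
  rfl

theorem exists_stepFun {W : Type*} [AddCommGroup W] [Module ℝ W] (μ : Set X → W)
    {φ : Set X →₀ ℝ} (hφ : φ ∈ Finsupp.supported ℝ ℝ S) :
    ∃ (n : ℕ) (c : Fin n → ℝ) (E : Fin n → Set X), (∀ j, E j ∈ S) ∧ stepFun c E = stepVal φ ∧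
      preInt μ φ = ∑ j, c j • μ (E j) := by
  let e := φ.support.equivFin
  have key : ∑ j, Finsupp.single ((e.symm j : Set X)) (φ (e.symm j)) = φ := by
    rw [e.symm.sum_comp fun E : φ.support => Finsupp.single (E : Set X) (φ E),
      Finset.sum_coe_sort φ.support fun E => Finsupp.single E (φ E)]
    exact Finsupp.sum_single φ
  refine ⟨_, fun j => φ (e.symm j), fun j => e.symm j,
    fun j => (Finsupp.mem_supported ℝ φ).1 hφ (e.symm j).2, ?_, ?_⟩
  · rw [stepFun_eq_stepVal, key]
  · rw [← preInt_sum_single, key]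

end Step

/-! ### Sigma-additivity over partitions -/

section Additive

variable {X : Type*} {S : Set (Set X)} {W : Type*} [AddCommGroup W]

/-- The definition only admits index types in `Type`; other countable types are transported to a
subset of ℕ. -/
theorem IsMeasureOn.hasSum [TopologicalSpace W] {μ : Set X → W} (hμ : IsMeasureOn S μ)
    {ι : Type*} [Countable ι] {A : Set X} {B : ι → Set X} (hA : A ∈ S) (hB : ∀ i, B i ∈ S)
    (hd : Pairwise fun i j => Disjoint (B i) (B j)) (h : A = ⋃ i, B i) :
    HasSum (fun i => μ (B i)) (μ A) := by
  obtain ⟨e, he⟩ := exists_injective_nat ι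
  let σ := Equiv.ofInjective e he
  have := hμ (Set.range e) A (fun l => B (σ.symm l)) hA (fun l => hB _)
    (fun k l hkl => hd fun h => hkl (σ.symm.injective h))
    (by rw [h]; exact (σ.symm.surjective.iUnion_comp B).symm)
  exact (σ.symm.hasSum_iff (f := fun i => μ (B i))).1 this

theorem hasSum_partition_mem [TopologicalSpace W] {μ : Set X → W} (hμ : IsMeasureOn S μ)
    {Λ : Type*} [Countable Λ] {B : Λ → Set X} (hB : ∀ l, B l ∈ S)
    (hd : Pairwise fun k l => Disjoint (B k) (B l)) {E : Set X} (hE : E ∈ S)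
    (hdec : ∀ l, Decides E (B l)) (hcov : E ⊆ ⋃ l, B l) :
    HasSum ({l | B l ⊆ E}.indicator fun l => μ (B l)) (μ E) := by
  rw [← hasSum_subtype_iff_indicator]
  refine hμ.hasSum (B := fun l : {l | B l ⊆ E} => B l) hE (fun l => hB l)
    (fun k l hkl => hd fun h => hkl (Subtype.ext h)) ?_
  apply Set.Subset.antisymm
  · intro x hx
    obtain ⟨l, hl⟩ := Set.mem_iUnion.1 (hcov hx)
    exact Set.mem_iUnion.2 ⟨⟨l, (hdec l).subset hl hx⟩, hl⟩
  · exact Set.iUnion_subset fun l => l.2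

end Additive

/-! ### Pre-integrals and localization -/

section Measure

variable {X : Type*} {S : Set (Set X)} {W : Type*} [AddCommGroup W] [Module ℝ W]

theorem preInt_mem_bilinearSum [TopologicalSpace W] {μ : Set X → W} {A : Set (ℝ × X)}
    {φ : Set X →₀ ℝ} (hφ : φ ∈ Finsupp.supported ℝ ℝ S) (hA : Approximates A (stepVal φ)) :
    preInt μ φ ∈ bilinearSum S μ A := by
  obtain ⟨n, c, E, hE, h, hI⟩ := exists_stepFun μ hφ
  exact subset_closure ⟨n, c, E, hE, h ▸ hA, hI⟩

theorem bilinearSum_subset [TopologicalSpace W] {μ : Set X → W} {A : Set (ℝ × X)} {U : Set W}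
    (hU : IsClosed U) (h : ∀ φ ∈ Finsupp.supported ℝ ℝ S, Approximates A (stepVal φ) →
      preInt μ φ ∈ U) : bilinearSum S μ A ⊆ U := by
  refine closure_minimal ?_ hU
  rintro w ⟨n, c, E, hE, hA, rfl⟩
  rw [← preInt_sum_single μ Finset.univ E c]
  exact h _ (sum_single_mem_supported (fun j _ => hE j) c) (stepFun_eq_stepVal c E ▸ hA)

/-- The pre-integral of a step-function is the unconditional sum over a partition. -/
theorem hasSum_partition [TopologicalSpace W] [IsTopologicalAddGroup W] [ContinuousSMul ℝ W]
    {μ : Set X → W} (hμ : IsMeasureOn S μ) {Λ : Type*} [Countable Λ] {B : Λ → Set X}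
    (hB : ∀ l, B l ∈ S) (hne : ∀ l, (B l).Nonempty)
    (hd : Pairwise fun k l => Disjoint (B k) (B l)) {φ : Set X →₀ ℝ}
    (hφ : φ ∈ Finsupp.supported ℝ ℝ S) (hdec : ∀ l, Resolves φ (B l))
    (hcov : ∀ E ∈ φ.support, E ⊆ ⋃ l, B l) {d : Λ → ℝ} (hdv : ∀ l, ∀ x ∈ B l, stepVal φ x = d l) :
    HasSum (fun l => d l • μ (B l)) (preInt μ φ) := by
  rw [preInt_apply]
  have key : ∀ E ∈ φ.support,
      HasSum (fun l => φ E • {l | B l ⊆ E}.indicator (fun l => μ (B l)) l) (φ E • μ E) :=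
    fun E hE => (hasSum_partition_mem hμ hB hd ((Finsupp.mem_supported ℝ φ).1 hφ hE)
      (fun l => hdec l E hE) (hcov E hE)).const_smul (φ E)
  convert hasSum_sum key using 2 with l
  obtain ⟨x, hx⟩ := hne l
  rw [← hdv l x hx, stepVal_eq_sum_subset (hdec l) hx, Finset.sum_smul]
  refine Finset.sum_congr rfl fun E _ => ?_
  by_cases h : B l ⊆ E <;> simp [h]

/-- To place a pre-integral in a closed set it suffices to consider finite families of small
pieces. -/
theorem preInt_mem_of_loc [TopologicalSpace W] [IsTopologicalAddGroup W] [ContinuousSMul ℝ W]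
    (hS : IsIntervalSystem S) {μ : Set X → W} (hμ : IsMeasureOn S μ) {φ : Set X →₀ ℝ}
    (hφ : φ ∈ Finsupp.supported ℝ ℝ S) {U : Set W} (hU : IsClosed U) {Q : Set X → Prop}
    (hQ : ∀ G H, H ⊆ G → Q G → Q H) {p : X → Prop}
    (hloc : Loc S (fun (_ : Unit) x => p x) (fun _ G => Q G)) (hp : ∀ E ∈ φ.support, ∀ x ∈ E, p x)
    (h : ∀ (ι : Type) (J : Finset ι) (B : ι → Set X) (d : ι → ℝ), (∀ i, B i ∈ S) →
      (∀ i, (B i).Nonempty) → Pairwise (fun k l => Disjoint (B k) (B l)) → (∀ i, Q (B i)) →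
      (∀ i, ∀ x ∈ B i, stepVal φ x = d i) → ∑ i ∈ J, d i • μ (B i) ∈ U) :
    preInt μ φ ∈ U := by
  have h𝒱 : (φ.support : Set (Set X)) ⊆ S := (Finsupp.mem_supported ℝ φ).1 hφ
  obtain ⟨Λ, hΛ, B, hBS, hBne, hBd, hcov, hB⟩ :=
    (((hloc.and hS (loc_resolves hS hφ) (fun _ _ _ h => hQ _ _ h)
      fun _ _ _ hH h => Resolves.anti hH h)).mono (P' := fun _ x => p x)
        (fun _ _ hx => ⟨hx, trivial⟩)
        (fun _ _ _ _ _ h => h)).exists_partition hS (Q := fun G => Q G ∧ Resolves φ G)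
      (fun G H hH hG => ⟨hQ G H hH hG.1, hG.2.anti hH⟩) h𝒱 φ.support.countable_toSet
      (fun x ⟨E, hE, hx⟩ => hp E hE x hx)
  choose z hz using hBne
  have hdv : ∀ l, ∀ x ∈ B l, stepVal φ x = stepVal φ (z l) := fun l x hx =>
    (hB l).2.eq hx (hz l)
  -- The pre-integral is the limit of its sums over finite subfamilies of the partition, and U is
  -- closed.
  refine hU.mem_of_tendsto (hasSum_partition hμ hBS (fun l => ⟨z l, hz l⟩) hBd hφ
    (fun l => (hB l).2) (fun E hE x hx => hcov ⟨E, hE, hx⟩) hdv) (Filter.Eventually.of_forall ?_)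
  intro J
  exact h Λ J B _ hBS (fun l => ⟨z l, hz l⟩) hBd (fun l => (hB l).1) hdv

end Measure

/-! ### Envelopes with small differences -/

section Small

variable {X : Type*} {S : Set (Set X)} {W : Type*} [AddCommGroup W] [Module ℝ W]

/-- Pre-integrals over finite disjoint families of differences of values allowed by `A` lie
in `U`. -/
def Small (S : Set (Set X)) (μ : Set X → W) (A : Set (ℝ × X)) (U : Set W) : Prop :=
  ∀ (ι : Type) (J : Finset ι) (B : ι → Set X) (y z : ι → ℝ), (∀ i ∈ J, B i ∈ S) →
    (J : Set ι).PairwiseDisjoint B → (∀ i ∈ J, y i ∈ fiberOn A (B i)) →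
    (∀ i ∈ J, z i ∈ fiberOn A (B i)) → ∑ i ∈ J, (y i - z i) • μ (B i) ∈ U

theorem Small.mono {μ : Set X → W} {𝒜 : Set (ℝ × X)} {U V : Set W} (h : Small S μ 𝒜 U)
    (hUV : U ⊆ V) : Small S μ 𝒜 V :=
  fun ι J B y z hB hd hy hz => hUV (h ι J B y z hB hd hy hz)

theorem approximates_modify {𝒜 : Set (ℝ × X)} {φ : Set X →₀ ℝ} {ι : Type*} {J : Finset ι}
    {B : ι → Set X} (hd : (J : Set ι).PairwiseDisjoint B) {p y : ι → ℝ}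
    (hp : ∀ i ∈ J, ∀ x ∈ B i, stepVal φ x = p i) (hy : ∀ i ∈ J, y i ∈ fiberOn 𝒜 (B i))
    (hφ : ∀ x, (∀ i ∈ J, x ∉ B i) → (stepVal φ x, x) ∈ 𝒜) :
    Approximates 𝒜 (stepVal (φ + ∑ i ∈ J, Finsupp.single (B i) (y i - p i))) := by
  intro x
  rw [map_add, Pi.add_apply]
  by_cases hx : ∃ i ∈ J, x ∈ B i
  · obtain ⟨i, hi, hxi⟩ := hx
    rw [stepVal_sum_single_of_mem hd _ hi hxi, hp i hi x hxi, add_sub_cancel]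
    exact hy i hi x hxi
  · push Not at hx
    rw [stepVal_sum_single_of_notMem _ hx, add_zero]
    exact hφ x hx

theorem fiberOn_anti {𝒜 : Set (ℝ × X)} {G H : Set X} (h : H ⊆ G) :
    fiberOn 𝒜 G ⊆ fiberOn 𝒜 H := fun _ hy x hx => hy x (h hx)

variable [TopologicalSpace W] [IsTopologicalAddGroup W] [ContinuousSMul ℝ W]

/-- On finitely many pieces where φ is constant, its values can be replaced by y or by z without
leaving 𝒜. The two resulting pre-integrals lie in P, and in their difference φ cancels. -/
theorem small_of_bilinearSum (hS : IsIntervalSystem S) {μ : Set X → W} (hμ : IsMeasureOn S μ)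
    {𝒜 : Set (ℝ × X)} {φ : Set X →₀ ℝ} (hφ : φ ∈ Finsupp.supported ℝ ℝ S)
    (hφ𝒜 : Approximates 𝒜 (stepVal φ)) {P U : Set W} (hP : bilinearSum S μ 𝒜 ⊆ P)
    (hU : IsClosed U) (hPU : ∀ u ∈ P, ∀ v ∈ P, u - v ∈ U) : Small S μ 𝒜 U := by
  intro κ I A y z hA hAd hy hz
  rw [← preInt_sum_single]
  refine preInt_mem_of_loc hS hμ (sum_single_mem_supported hA _) hU
    (Q := fun G => (∃ i ∈ I, G ⊆ A i) ∧ Resolves φ G)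
    (fun G H hH hG => ⟨hG.1.imp fun i hi => ⟨hi.1, hH.trans hi.2⟩, hG.2.anti hH⟩)
    (p := fun x => ∃ i ∈ I, x ∈ A i) ?_ ?_ ?_
  · refine (Loc.and hS (Loc.of_countable (P := fun _ x => ∃ i ∈ I, x ∈ A i)
      (R := fun _ G => ∃ i ∈ I, G ⊆ A i) (A '' I)
      (by rintro _ ⟨i, hi, rfl⟩; exact hA i hi) (I.countable_toSet.image A) ?_)
      (loc_resolves hS hφ) (fun _ G H hH ⟨i, hi, hG⟩ => ⟨i, hi, hH.trans hG⟩)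
      fun _ _ _ hH h => Resolves.anti hH h).mono (fun _ x hx => ⟨hx, trivial⟩)
        (fun _ _ _ _ _ h => h)
    rintro x - ⟨i, hi, hx⟩
    exact ⟨A i, ⟨i, hi, rfl⟩, hx, i, hi, subset_rfl⟩
  · intro E hE x hx
    obtain ⟨i, hi, rfl⟩ := mem_of_mem_support_sum_single hE
    exact ⟨i, hi, hx⟩
  · intro ι J B d hB hne hBd hQ hdv
    choose k hk hBk using fun i => (hQ i).1
    choose w hw using hne
    have hval : ∀ i, ∀ x ∈ B i, stepVal φ x = stepVal φ (w i) := fun i x hx =>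
      (hQ i).2.eq hx (hw i)
    have key : ∀ t : κ → ℝ, (∀ i ∈ I, t i ∈ fiberOn 𝒜 (A i)) →
        preInt μ φ + ∑ i ∈ J, (t (k i) - stepVal φ (w i)) • μ (B i) ∈ P := by
      intro t ht
      rw [← preInt_sum_single, ← map_add]
      refine hP (preInt_mem_bilinearSum (Submodule.add_mem _ hφ
        (sum_single_mem_supported (fun i _ => hB i) _)) ?_)
      exact approximates_modify (fun i _ j _ hij => hBd hij) (fun i _ => hval i)
        (fun i _ => fiberOn_anti (hBk i) (ht _ (hk i))) fun x _ => hφ𝒜 x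
    have := hPU _ (key y hy) _ (key z hz)
    rw [add_sub_add_left_eq_sub, ← Finset.sum_sub_distrib] at this
    convert this using 2 with i
    rw [← sub_smul, ← hdv i (w i) (hw i), stepVal_sum_single_of_mem hAd _ (hk i) (hBk i (hw i))]
    ring_nf

/-- A converse to `small_of_bilinearSum`: on pieces resolved by both step-functions, their constants
are admissible values. -/
theorem Small.preInt_sub_mem (hS : IsIntervalSystem S) {μ : Set X → W} (hμ : IsMeasureOn S μ)
    {𝒜 : Set (ℝ × X)} {U : Set W} (h : Small S μ 𝒜 U) (hU : IsClosed U) {φ ψ : Set X →₀ ℝ}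
    (hφ : φ ∈ Finsupp.supported ℝ ℝ S) (hψ : ψ ∈ Finsupp.supported ℝ ℝ S)
    (hφ𝒜 : Approximates 𝒜 (stepVal φ)) (hψ𝒜 : Approximates 𝒜 (stepVal ψ)) :
    preInt μ φ - preInt μ ψ ∈ U := by
  rw [← map_sub]
  refine preInt_mem_of_loc hS hμ (Submodule.sub_mem _ hφ hψ) hU
    (Q := fun G => Resolves φ G ∧ Resolves ψ G)
    (fun G H hH hG => ⟨hG.1.anti hH, hG.2.anti hH⟩) (p := fun _ => True ∧ True)
    (Loc.and hS (loc_resolves hS hφ) (loc_resolves hS hψ) (fun _ _ _ hH h => Resolves.anti hH h)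
      fun _ _ _ hH h => Resolves.anti hH h) (fun _ _ _ _ => ⟨trivial, trivial⟩) ?_
  intro ι J B d hB hne hBd hQ hdv
  choose w hw using hne
  have := h ι J B (fun i => stepVal φ (w i)) (fun i => stepVal ψ (w i)) (fun i _ => hB i)
    (fun i _ j _ hij => hBd hij)
    (fun i _ x hx => by rw [(hQ i).1.eq (hw i) hx]; exact hφ𝒜 x)
    (fun i _ x hx => by rw [(hQ i).2.eq (hw i) hx]; exact hψ𝒜 x)
  convert this using 3 with i
  rw [← hdv i (w i) (hw i), map_sub, Pi.sub_apply]

end Small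

/-! ### Finite selections from semivariations -/

section Semivariation

variable {X : Type*} {S : Set (Set X)} {W : Type*} [AddCommGroup W] [Module ℝ W]

/-- The finite sums whose closure is `svarSet S μ c E`. -/
def svarPre (S : Set (Set X)) (μ : Set X → W) (c : ℝ) (E : Set X) : Set W :=
  {w | ∃ (n : ℕ) (A : Fin n → Set X),
    (∀ j, A j ∈ S) ∧ (∀ j, A j ⊆ E) ∧ Pairwise (fun i j => Disjoint (A i) (A j)) ∧
    w = ∑ j, c • μ (A j)}

theorem sum_mem_svarPre (μ : Set X → W) {c : ℝ} {E : Set X} {ι : Type*} {J : Finset ι}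
    {A : ι → Set X} (hA : ∀ i ∈ J, A i ∈ S) (hAE : ∀ i ∈ J, A i ⊆ E)
    (hd : (J : Set ι).PairwiseDisjoint A) : ∑ i ∈ J, c • μ (A i) ∈ svarPre S μ c E := by
  let e := J.equivFin
  refine ⟨_, fun j => A (e.symm j), fun j => hA _ (e.symm j).2, fun j => hAE _ (e.symm j).2,
    fun i j hij => hd (e.symm i).2 (e.symm j).2 fun h => hij (e.symm.injective (Subtype.ext h)), ?_⟩
  rw [e.symm.sum_comp fun i : J => c • μ (A i), Finset.sum_coe_sort J fun i => c • μ (A i)]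

theorem zero_mem_svarPre (μ : Set X → W) (c : ℝ) (E : Set X) : (0 : W) ∈ svarPre S μ c E := by
  simpa using sum_mem_svarPre (S := S) μ (c := c) (E := E) (J := (∅ : Finset ℕ))
    (A := fun _ => ∅) (by simp) (by simp) (by simp)

/-- Finite sums of elements of the sets `svarPre S μ (c l) (E l)` with `p l` lie in `U`. -/
def SvSums (S : Set (Set X)) (μ : Set X → W) {Λ : Type*} (c : Λ → ℝ) (E : Λ → Set X)
    (p : Λ → Prop) (U : Set W) : Prop :=
  ∀ (L : Finset Λ) (v : Λ → W), (∀ l ∈ L, p l) → (∀ l ∈ L, v l ∈ svarPre S μ (c l) (E l)) →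
    ∑ l ∈ L, v l ∈ U

variable {Λ : Type} {c : Λ → ℝ} {E : Λ → Set X} {p : Λ → Prop} {U : Set W} {μ : Set X → W}

/-- The sets assigned to one index k form a single selection from `svarPre S μ (c k) (E k)`. -/
theorem SvSums.family (h : SvSums S μ c E p U) {ι : Type*} {J : Finset ι} {A : ι → Set X}
    {l : ι → Λ} (hA : ∀ i ∈ J, A i ∈ S) (hd : (J : Set ι).PairwiseDisjoint A)
    (hAE : ∀ i ∈ J, A i ⊆ E (l i)) (hp : ∀ i ∈ J, p (l i)) :
    ∑ i ∈ J, c (l i) • μ (A i) ∈ U := by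
  classical
  have := h (J.image l) (fun k => ∑ i ∈ J with l i = k, c k • μ (A i)) ?_ ?_
  · rw [← Finset.sum_fiberwise_of_maps_to (g := l) (t := J.image l)
      fun i hi => Finset.mem_image_of_mem l hi]
    convert this using 2 with k
    refine Finset.sum_congr rfl fun i hi => ?_
    rw [(Finset.mem_filter.1 hi).2]
  · intro k hk
    obtain ⟨i, hi, rfl⟩ := Finset.mem_image.1 hk
    exact hp i hi
  · intro k _
    refine sum_mem_svarPre μ (fun i hi => hA i (Finset.mem_filter.1 hi).1) (fun i hi => ?_)
      (hd.subset fun i hi => (Finset.mem_filter.1 hi).1)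
    rw [← (Finset.mem_filter.1 hi).2]
    exact hAE i (Finset.mem_filter.1 hi).1

/-- Disjointness of the sets E l makes the selections for different l into one disjoint family, to
which bounds such as `Small` apply. -/
theorem svSums_of_family (hE : Pairwise fun k l => Disjoint (E k) (E l))
    (h : ∀ (ι : Type) (J : Finset ι) (A : ι → Set X) (l : ι → Λ), (∀ i ∈ J, A i ∈ S) →
      (J : Set ι).PairwiseDisjoint A → (∀ i ∈ J, A i ⊆ E (l i)) → (∀ i ∈ J, p (l i)) →
      ∑ i ∈ J, c (l i) • μ (A i) ∈ U) : SvSums S μ c E p U := by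
  classical
  intro L v hp hv
  have hv' : ∀ l : Λ, ∃ (n : ℕ) (A : Fin n → Set X), l ∈ L → (∀ j, A j ∈ S) ∧ (∀ j, A j ⊆ E l) ∧
      Pairwise (fun i j => Disjoint (A i) (A j)) ∧ v l = ∑ j, c l • μ (A j) := by
    intro l
    by_cases hl : l ∈ L
    · obtain ⟨n, A, hA⟩ := hv l hl
      exact ⟨n, A, fun _ => hA⟩
    · exact ⟨0, fun _ => ∅, fun h => absurd h hl⟩
  choose n A hA using hv'
  have := h (Σ l, Fin (n l)) (L.sigma fun _ => Finset.univ) (fun q => A q.1 q.2) (fun q => q.1)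
    (fun q hq => (hA q.1 (Finset.mem_sigma.1 hq).1).1 q.2) ?_
    (fun q hq => (hA q.1 (Finset.mem_sigma.1 hq).1).2.1 q.2)
    (fun q hq => hp q.1 (Finset.mem_sigma.1 hq).1)
  · rw [Finset.sum_sigma] at this
    convert this using 1
    exact Finset.sum_congr rfl fun l hl => (hA l hl).2.2.2
  · rintro ⟨k, i⟩ hk ⟨l, j⟩ hl hne
    have hk' := (Finset.mem_sigma.1 hk).1
    have hl' := (Finset.mem_sigma.1 hl).1
    by_cases hkl : k = l
    · subst hkl
      exact (hA k hk').2.2.1 fun h : i = j => hne (by rw [h])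
    · exact (hE hkl).mono ((hA k hk').2.1 i) ((hA l hl').2.1 j)

theorem SvSums.comp {Λ Λ' : Type*} {c : Λ → ℝ} {E : Λ → Set X} {p : Λ → Prop} {U : Set W}
    (h : SvSums S μ c E p U) {e : Λ' → Λ} (he : Function.Injective e) (hp : ∀ l, p (e l)) :
    SvSums S μ (fun l => c (e l)) (fun l => E (e l)) (fun _ => True) U := by
  intro L v _ hv
  have := h (L.map ⟨e, he⟩) (Function.extend e v 0)
    (fun l hl => by
      obtain ⟨k, -, rfl⟩ := Finset.mem_map.1 hl
      exact hp k)
    (fun l hl => by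
      obtain ⟨k, hk, rfl⟩ := Finset.mem_map.1 hl
      simpa [he.extend_apply] using hv k hk)
  simpa [he.extend_apply] using this

/-- A selection across levels is regrouped level by level, so that the sum estimates of a `NhdChain`
become applicable. -/
theorem SvSums.exists_sigma {Λ : ℕ → Type} {c : ∀ n, Λ n → ℝ} {E : ∀ n, Λ n → Set X}
    {p : (Σ n, Λ n) → Prop} {Z : ℕ → Set W}
    (h : ∀ n, SvSums S μ (c n) (E n) (fun l => p ⟨n, l⟩) (Z n)) {L : Finset (Σ n, Λ n)}
    {v : (Σ n, Λ n) → W} (hp : ∀ l ∈ L, p l)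
    (hv : ∀ l ∈ L, v l ∈ svarPre S μ (c l.1 l.2) (E l.1 l.2)) :
    ∃ (F : Finset ℕ) (z : ℕ → W), (∀ n, z n ∈ Z n) ∧ ∑ l ∈ L, v l = ∑ n ∈ F, z n := by
  classical
  refine ⟨L.image Sigma.fst,
    fun n => ∑ l ∈ L.preimage (Sigma.mk n) sigma_mk_injective.injOn, v ⟨n, l⟩, fun n => ?_, ?_⟩
  · exact h n _ (fun l => v ⟨n, l⟩) (fun l hl => hp _ (Finset.mem_preimage.1 hl))
      fun l hl => hv _ (Finset.mem_preimage.1 hl)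
  · rw [← Finset.sum_sigma (L.image Sigma.fst)
      (fun n => L.preimage (Sigma.mk n) sigma_mk_injective.injOn) v,
      Finset.sigma_image_fst_preimage_mk]

theorem Small.svSums {μ : Set X → W} {𝒜 : Set (ℝ × X)} {U : Set W} (h : Small S μ 𝒜 U) {Λ : Type}
    {B : Λ → Set X} (hBd : Pairwise fun k l => Disjoint (B k) (B l)) {p q : Λ → ℝ}
    (hp : ∀ l, p l ∈ fiberOn 𝒜 (B l)) (hq : ∀ l, q l ∈ fiberOn 𝒜 (B l)) :
    SvSums S μ (fun l => p l - q l) B (fun _ => True) U :=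
  svSums_of_family hBd fun ι J A l hA hAd hAB _ =>
    h ι J A (fun i => p (l i)) (fun i => q (l i)) hA hAd
      (fun i hi => fiberOn_anti (hAB i hi) (hp _)) fun i hi => fiberOn_anti (hAB i hi) (hq _)

end Semivariation

/-! ### Uniform smallness of tails -/

section Tails

variable {W : Type*} [AddCommGroup W]

/-- If all selections from the sets `V l` are summable, then their tails are uniformly small. -/
theorem exists_uniform_tail [TopologicalSpace W] [IsTopologicalAddGroup W] {Λ : Type*}
    {V : Λ → Set W} (h0 : ∀ l, 0 ∈ V l)
    (hV : ∀ v : Λ → W, (∀ l, v l ∈ V l) → Summable v) {T : Set W} (hT : T ∈ 𝓝 (0 : W)) :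
    ∃ K : Finset Λ, ∀ (L : Finset Λ) (v : Λ → W), (∀ l ∈ L, l ∉ K) → (∀ l ∈ L, v l ∈ V l) →
      ∑ l ∈ L, v l ∈ T := by
  classical
  by_contra hcon
  push Not at hcon
  -- If the claim fails, there are pairwise disjoint finite blocks with sums outside T. Gluing them
  -- gives one selection, which is summable by hypothesis.
  obtain ⟨q, hq, hqd⟩ := exists_seq_of_forall_finset_exists
    (fun q : Finset Λ × (Λ → W) => (∀ l ∈ q.1, q.2 l ∈ V l) ∧ ∑ l ∈ q.1, q.2 l ∉ T)
    (fun q r => Disjoint q.1 r.1) fun s _ => by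
      obtain ⟨L, v, hL, hv, hT⟩ := hcon (s.biUnion fun q => q.1)
      refine ⟨(L, v), ⟨hv, hT⟩, fun q hq => Finset.disjoint_left.2 fun l hl hl' => ?_⟩
      exact hL l hl' (Finset.mem_biUnion.2 ⟨q, hq, hl⟩)
  have hdisj : ∀ m n, m ≠ n → Disjoint (q m).1 (q n).1 := fun m n hmn => by
    rcases lt_or_gt_of_ne hmn with h | h
    · exact hqd m n h
    · exact (hqd n m h).symm
  let v : Λ → W := fun l => if h : ∃ n, l ∈ (q n).1 then (q h.choose).2 l else 0
  have hv : ∀ n, ∀ l ∈ (q n).1, v l = (q n).2 l := by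
    intro n l hl
    have h : ∃ n, l ∈ (q n).1 := ⟨n, hl⟩
    have : h.choose = n := by
      by_contra hne
      exact Finset.disjoint_left.1 (hdisj _ _ hne) h.choose_spec hl
    simp only [v, dif_pos h, this]
  have hsum : Summable v := hV v fun l => by
    by_cases h : ∃ n, l ∈ (q n).1
    · simp only [v, dif_pos h]
      exact (hq _).1 l h.choose_spec
    · simp only [v, dif_neg h]
      exact h0 l
  obtain ⟨s, hs⟩ := hsum.vanishing hT
  -- Infinitely many disjoint blocks cannot all meet the finite set s.
  obtain ⟨n, hn⟩ : ∃ n, Disjoint (q n).1 s := by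
    by_contra hcon
    push Not at hcon
    choose g hg using fun n => Finset.not_disjoint_iff.1 (hcon n)
    have hinj : Function.Injective g := fun m n hmn => by
      by_contra hne
      exact Finset.disjoint_left.1 (hdisj m n hne) (hg m).1 (hmn ▸ (hg n).1)
    exact not_injective_infinite_finite (fun n => (⟨g n, (hg n).2⟩ : s))
      fun m n h => hinj (Subtype.ext_iff.1 h)
  refine (hq n).2 ?_
  rw [← Finset.sum_congr rfl (hv n)]
  exact hs _ hn

variable {X : Type*} {S : Set (Set X)} [UniformSpace W] [IsUniformAddGroup W] [CompleteSpace W]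

/-- For the l with B l ⊆ E, the chosen sets A l j and a countable partition of each remainder of B l
decompose E, so sigma-additivity sums them all. Completeness allows passing to the subfamily of the
A l j and grouping it by l. -/
theorem summable_selection_mem (hS : IsIntervalSystem S) {μ : Set X → W} (hμ : IsMeasureOn S μ)
    {Λ : Type*} [Countable Λ] {B : Λ → Set X} (hB : ∀ l, B l ∈ S)
    (hd : Pairwise fun k l => Disjoint (B k) (B l)) {E : Set X} (hE : E ∈ S)
    (hdec : ∀ l, Decides E (B l)) (hcov : E ⊆ ⋃ l, B l) {n : Λ → ℕ}
    {A : ∀ l, Fin (n l) → Set X} (hA : ∀ l j, A l j ∈ S) (hAB : ∀ l j, A l j ⊆ B l)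
    (hAd : ∀ l, Pairwise fun i j => Disjoint (A l i) (A l j)) :
    Summable ({l | B l ⊆ E}.indicator fun l => ∑ j, μ (A l j)) := by
  choose C hCS hC hCd hCU using fun l =>
    (IsSigma.of_mem (hB l)).diff_biUnion hS Finset.univ (B := A l) fun j _ => hA l j
  have : ∀ l, Countable (C l) := fun l => (hC l).to_subtype
  let F : (Σ l : {l | B l ⊆ E}, Fin (n l) ⊕ C l) → Set X := fun q =>
    Sum.elim (A q.1) (fun G => (G : Set X)) q.2
  have hFsub : ∀ q, F q ⊆ B q.1 := by
    rintro ⟨l, j | G⟩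
    · exact hAB l j
    · have : (G : Set X) ⊆ B l \ ⋃ j ∈ Finset.univ, A l j := by
        rw [hCU l]; exact Set.subset_sUnion_of_mem G.2
      exact this.trans Set.sdiff_subset
  have hAC : ∀ l (j : Fin (n l)) (G : C l), Disjoint (A l j) (G : Set X) := by
    intro l j G
    have : (G : Set X) ⊆ B l \ ⋃ j ∈ Finset.univ, A l j := by
      rw [hCU l]; exact Set.subset_sUnion_of_mem G.2
    refine Set.disjoint_left.2 fun x hx hxG => (this hxG).2 ?_
    exact Set.mem_biUnion (Finset.mem_coe.2 (Finset.mem_univ j)) hx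
  have hsum : HasSum (fun q => μ (F q)) (μ E) := by
    refine hμ.hasSum hE ?_ ?_ ?_
    · rintro ⟨l, j | G⟩
      · exact hA l j
      · exact hCS l G.2
    · rintro ⟨k, a⟩ ⟨l, b⟩ hne
      by_cases hkl : k = l
      · subst hkl
        rcases a with i | G <;> rcases b with j | H
        · exact hAd k fun h => hne (by rw [h])
        · exact hAC k i H
        · exact (hAC k j G).symm
        · exact hCd k G.2 H.2 fun h => hne (by rw [Subtype.ext h])
      · exact (hd fun h => hkl (Subtype.ext h)).mono (hFsub ⟨k, a⟩) (hFsub ⟨l, b⟩)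
    · apply Set.Subset.antisymm
      · intro x hx
        obtain ⟨l, hl⟩ := Set.mem_iUnion.1 (hcov hx)
        have hlE : B l ⊆ E := (hdec l).subset hl hx
        by_cases hxA : ∃ j, x ∈ A l j
        · obtain ⟨j, hj⟩ := hxA
          exact Set.mem_iUnion.2 ⟨⟨⟨l, hlE⟩, Sum.inl j⟩, hj⟩
        · have : x ∈ ⋃₀ C l := by
            rw [← hCU l]
            exact ⟨hl, by simpa using hxA⟩
          obtain ⟨G, hG, hxG⟩ := this
          exact Set.mem_iUnion.2 ⟨⟨⟨l, hlE⟩, Sum.inr ⟨G, hG⟩⟩, hxG⟩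
      · exact Set.iUnion_subset fun q => (hFsub q).trans q.1.2
  let j : (Σ l : {l | B l ⊆ E}, Fin (n l)) → (Σ l : {l | B l ⊆ E}, Fin (n l) ⊕ C l) :=
    Sigma.map id fun _ => Sum.inl
  have hj : Function.Injective j :=
    Function.Injective.sigma_map Function.injective_id fun _ => Sum.inl_injective
  have h2 := (hsum.summable.comp_injective hj).sigma
  simp only [tsum_fintype] at h2
  exact summable_subtype_iff_indicator.1 h2

variable [Module ℝ W] [ContinuousSMul ℝ W]

/-- The tails of the semivariations of the pieces of a step-function are small. -/
theorem exists_svSums_tail (hS : IsIntervalSystem S) {μ : Set X → W} (hμ : IsMeasureOn S μ)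
    {Λ : Type*} [Countable Λ] {B : Λ → Set X} (hB : ∀ l, B l ∈ S) (hne : ∀ l, (B l).Nonempty)
    (hd : Pairwise fun k l => Disjoint (B k) (B l)) {φ : Set X →₀ ℝ}
    (hφ : φ ∈ Finsupp.supported ℝ ℝ S) (hdec : ∀ l, Resolves φ (B l))
    (hcov : ∀ E ∈ φ.support, E ⊆ ⋃ l, B l) {d : Λ → ℝ} (hdv : ∀ l, ∀ x ∈ B l, stepVal φ x = d l)
    {T : Set W} (hT : T ∈ 𝓝 (0 : W)) :
    ∃ K : Finset Λ, SvSums S μ d B (fun l => l ∉ K) T := by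
  refine exists_uniform_tail (fun l => zero_mem_svarPre μ (d l) (B l)) ?_ hT
  intro v hv
  choose n A hA hAB hAd hvA using hv
  have key : ∀ E ∈ φ.support,
      Summable fun l => φ E • {l | B l ⊆ E}.indicator (fun l => ∑ j, μ (A l j)) l := fun E hE =>
    (summable_selection_mem hS hμ hB hd ((Finsupp.mem_supported ℝ φ).1 hφ hE)
      (fun l => hdec l E hE) (hcov E hE) hA hAB hAd).const_smul (φ E)
  convert summable_sum key using 2 with l
  obtain ⟨x, hx⟩ := hne l
  rw [hvA, ← Finset.smul_sum, ← hdv l x hx, stepVal_eq_sum_subset (hdec l) hx, Finset.sum_smul]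
  refine Finset.sum_congr rfl fun E _ => ?_
  by_cases h : B l ⊆ E <;> simp [h]

end Tails

/-! ### Envelopes through local generation -/

section Envelopes

variable {X : Type*} {S : Set (Set X)}

/-- Countably generated sets: locally determined by countably many rectangles, with only the
value zero off a countable union of members of `S`. -/
structure IsGen (S : Set (Set X)) (𝒜 : Set (ℝ × X)) : Prop where
  loc : Loc S (fun y x => (y, x) ∈ 𝒜) (fun y G => y ∈ fiberOn 𝒜 G)
  supp : ∃ 𝒟 ⊆ S, 𝒟.Countable ∧ ∀ x ∉ ⋃₀ 𝒟, ∀ y, (y, x) ∈ 𝒜 → y = 0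

theorem hered_fiberOn (𝒜 : Set (ℝ × X)) : Hered (fun y G => y ∈ fiberOn 𝒜 G) :=
  fun _ _ _ hH hy => fiberOn_anti hH hy

theorem IsEnvelope.exists_step {𝒜 : Set (ℝ × X)} (h : IsEnvelope S 𝒜) :
    ∃ φ ∈ Finsupp.supported ℝ ℝ S, Approximates 𝒜 (stepVal φ) := by
  obtain ⟨n, c, E, hE, hA⟩ := h.1
  exact ⟨_, sum_single_mem_supported (fun j _ => hE j) c, stepFun_eq_stepVal c E ▸ hA⟩

theorem IsEnvelope.isGen (hS : IsIntervalSystem S) {𝒜 : Set (ℝ × X)} (h : IsEnvelope S 𝒜) :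
    IsGen S 𝒜 := by
  obtain ⟨φ, hφ, hφ𝒜⟩ := h.exists_step
  obtain ⟨𝒟, h𝒟S, h𝒟, hgen⟩ := h.2
  have hmem : ∀ x y, (y, x) ∈ 𝒜 → (∃ D ∈ 𝒟, x ∈ D ∧ y ∈ fiberOn 𝒜 D) ∨
      (x ∉ ⋃₀ 𝒟 ∧ y = 0) := by
    intro x y hxy
    rw [hgen] at hxy
    rcases hxy with hxy | hxy
    · simp only [Set.mem_iUnion] at hxy
      obtain ⟨D, hD, hy, hx⟩ := hxy
      exact Or.inl ⟨D, hD, hx, hy⟩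
    · exact Or.inr ⟨hxy.2, hxy.1⟩
  have hoff : ∀ x ∉ ⋃₀ 𝒟, ∀ y, (y, x) ∈ 𝒜 → y = 0 := by
    intro x hx y hxy
    rcases hmem x y hxy with ⟨D, hD, hxD, -⟩ | h
    · exact absurd ⟨D, hD, hxD⟩ hx
    · exact h.2
  refine ⟨?_, 𝒟, h𝒟S, h𝒟, hoff⟩
  have h1 : Loc S (fun y x => ∃ D ∈ 𝒟, x ∈ D ∧ y ∈ fiberOn 𝒜 D) (fun y G => y ∈ fiberOn 𝒜 G) :=
    Loc.of_countable 𝒟 h𝒟S h𝒟 fun x y h => h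
  -- At points off ⋃₀ 𝒟 the step-function contained in 𝒜 must vanish; it then vanishes on a whole
  -- resolved piece, which makes 0 admissible there.
  have h2 : Loc S (fun y x => x ∉ ⋃₀ 𝒟 ∧ y = 0) (fun y G => y ∈ fiberOn 𝒜 G) := by
    refine (loc_resolves (Y := ℝ) hS hφ).mono (fun _ _ _ => trivial) ?_
    rintro y x G ⟨hx, rfl⟩ hxG hG z hz
    have h0 : stepVal φ x = 0 := hoff x hx _ (hφ𝒜 x)
    rw [← h0, hG.eq hxG hz]
    exact hφ𝒜 z
  exact (h1.or h2).mono (fun y x hxy => hmem x y hxy) fun _ _ _ _ _ h => h.elim id id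

/-- The local rectangles are intersected with 𝒟, so that the generating system still has union ⋃₀ 𝒟.
Off that union, 0 is the only admissible value, and it is admissible because φ takes it. -/
theorem IsGen.isEnvelope (hS : IsIntervalSystem S) {𝒜 : Set (ℝ × X)} (h : IsGen S 𝒜)
    {φ : Set X →₀ ℝ} (hφ : φ ∈ Finsupp.supported ℝ ℝ S) (hφ𝒜 : Approximates 𝒜 (stepVal φ)) :
    IsEnvelope S 𝒜 := by
  refine ⟨?_, ?_⟩
  · obtain ⟨n, c, E, hE, hstep, -⟩ := exists_stepFun (W := ℝ) (fun _ => 0) hφ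
    exact ⟨n, c, E, hE, hstep ▸ hφ𝒜⟩
  · obtain ⟨𝒟, h𝒟S, h𝒟, hoff⟩ := h.supp
    obtain ⟨C, hCS, hC, hloc⟩ := h.loc.cover h𝒟S h𝒟
    obtain ⟨F, hFS, hF, -, hFD, hF'⟩ := exists_inter_family hS hCS h𝒟S hC h𝒟
    have hU : ⋃₀ (F ∪ 𝒟) = ⋃₀ 𝒟 := by
      apply Set.Subset.antisymm
      · rintro x ⟨G, hG | hG, hx⟩
        · obtain ⟨D, hD, hGD⟩ := hFD G hG
          exact ⟨D, hD, hGD hx⟩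
        · exact ⟨G, hG, hx⟩
      · exact Set.sUnion_subset_sUnion Set.subset_union_right
    refine ⟨F ∪ 𝒟, Set.union_subset hFS h𝒟S, hF.union h𝒟, ?_⟩
    unfold generated
    rw [hU]
    apply Set.Subset.antisymm
    · rintro ⟨y, x⟩ hxy
      by_cases hx : x ∈ ⋃₀ 𝒟
      · obtain ⟨G, hG, hxG, hy⟩ := hloc x hx y hxy
        obtain ⟨D, hD, hxD⟩ := hx
        obtain ⟨H, hH, hxH, hHG, -⟩ := hF' x G hG D hD hxG hxD
        exact Or.inl (Set.mem_biUnion (Or.inl hH) ⟨fiberOn_anti hHG hy, hxH⟩)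
      · exact Or.inr ⟨hoff x hx y hxy, hx⟩
    · rintro ⟨y, x⟩ (hxy | ⟨hy, hx⟩)
      · simp only [Set.mem_iUnion] at hxy
        obtain ⟨D, -, hy, hxD⟩ := hxy
        exact hy x hxD
      · have hy : y = 0 := hy
        rw [hy, ← hoff x hx _ (hφ𝒜 x)]
        exact hφ𝒜 x

end Envelopes

/-! ### Splicing an envelope with a step-function -/

section Splice

variable {X : Type*} {S : Set (Set X)} {W : Type*} [AddCommGroup W] [Module ℝ W]
  [TopologicalSpace W] [IsTopologicalAddGroup W] [ContinuousSMul ℝ W]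

/-- The part of `𝒜` over `A`, together with the graph of a step-function off a finite union of
sets. -/
def spliced (𝒜 : Set (ℝ × X)) (A : Set X) (ψ : Set X →₀ ℝ) (D : Set X) : Set (ℝ × X) :=
  {q | (q.2 ∈ A ∧ q ∈ 𝒜) ∨ (q.1 = stepVal ψ q.2 ∧ q.2 ∉ D)}

theorem isGen_spliced (hS : IsIntervalSystem S) {𝒜 : Set (ℝ × X)} (h𝒜 : IsGen S 𝒜) {A : Set X}
    (hA : Loc S (fun (_ : ℝ) _ => True) (fun _ G => Decides A G)) {ψ : Set X →₀ ℝ}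
    (hψ : ψ ∈ Finsupp.supported ℝ ℝ S) {D : Set X}
    (hD : Loc S (fun (_ : ℝ) _ => True) (fun _ G => Decides D G)) :
    IsGen S (spliced 𝒜 A ψ D) := by
  refine ⟨?_, ?_⟩
  · have h1 := (Loc.and hS h𝒜.loc hA (hered_fiberOn 𝒜) fun _ _ _ hH h => Decides.anti hH h).mono
      (P' := fun y x => x ∈ A ∧ (y, x) ∈ 𝒜) (R' := fun y G => y ∈ fiberOn (spliced 𝒜 A ψ D) G)
      (fun y x h => ⟨h.2, trivial⟩) fun y x G hx hxG hG z hz =>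
        Or.inl ⟨hG.2.subset hxG hx.1 hz, hG.1 z hz⟩
    have h2 := (Loc.and hS (loc_resolves (Y := ℝ) hS hψ) hD
      (fun _ _ _ hH h => Resolves.anti hH h) fun _ _ _ hH h => Decides.anti hH h).mono
      (P' := fun y x => y = stepVal ψ x ∧ x ∉ D)
      (R' := fun y G => y ∈ fiberOn (spliced 𝒜 A ψ D) G)
      (fun y x h => ⟨trivial, trivial⟩) fun y x G hx hxG hG z hz =>
        Or.inr ⟨hx.1.trans (hG.1.eq hxG hz), Set.disjoint_left.1 (hG.2.disjoint hxG hx.2) hz⟩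
    exact (h1.or h2).mono (fun _ _ h => h) fun _ _ _ _ _ h => h.elim id id
  · obtain ⟨𝒟, h𝒟S, h𝒟, hoff⟩ := h𝒜.supp
    refine ⟨𝒟 ∪ ψ.support, Set.union_subset h𝒟S ((Finsupp.mem_supported ℝ ψ).1 hψ),
      h𝒟.union ψ.support.countable_toSet, fun x hx y hxy => ?_⟩
    rcases hxy with ⟨-, hxy⟩ | ⟨hxy, -⟩
    · exact hoff x (fun ⟨E, hE, hxE⟩ => hx ⟨E, Or.inl hE, hxE⟩) y hxy
    · exact Eq.trans hxy (stepVal_eq_zero fun E hE hxE => hx ⟨E, Or.inr hE, hxE⟩)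

/-- Inside A, an admissible value that does not come from 𝒜 equals ψ; replacing it by φ brings it
back into 𝒜 and costs φ - ψ. This happens only off D, hence on pieces B l with l ∉ K, or where φ and
ψ both vanish. A difference y - z thus has the form u - t + t' of `hUT`. Off A both values equal ψ
and nothing is contributed. -/
theorem small_spliced (hS : IsIntervalSystem S) {μ : Set X → W} (hμ : IsMeasureOn S μ)
    {𝒜 : Set (ℝ × X)} (h𝒜 : IsGen S 𝒜) {φ ψ : Set X →₀ ℝ}
    (hφ : φ ∈ Finsupp.supported ℝ ℝ S) (hφ𝒜 : Approximates 𝒜 (stepVal φ))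
    (hψ : ψ ∈ Finsupp.supported ℝ ℝ S) {U T U' : Set W} (hU : Small S μ 𝒜 U) (hU' : IsClosed U')
    (hUT : ∀ u ∈ U, ∀ t ∈ T, ∀ t' ∈ T, u - t + t' ∈ U') {A : Set X}
    (hA : Loc S (fun (_ : ℝ) _ => True) (fun _ G => Decides A G)) {Λ : Type} [Countable Λ]
    {B : Λ → Set X} (hB : ∀ l, B l ∈ S) {d : Λ → ℝ}
    (hcov : ∀ E ∈ φ.support ∪ ψ.support, E ⊆ ⋃ l, B l)
    (hdv : ∀ l, ∀ x ∈ B l, stepVal φ x - stepVal ψ x = d l) {K : Finset Λ} {D : Set X}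
    (hD : Loc S (fun (_ : ℝ) _ => True) (fun _ G => Decides D G))
    (hDK : ∀ l ∈ K, ∀ x ∈ B l, x ∈ A → x ∈ D)
    (hK : SvSums S μ d B (fun l => l ∉ K) T) : Small S μ (spliced 𝒜 A ψ D) U' := by
  classical
  intro κ I E y z hE hEd hy hz
  rw [← preInt_sum_single]
  let α : ℝ → Set X → Prop := fun t G => (G ⊆ A ∧ t ∈ fiberOn 𝒜 G) ∨
    ((∀ x ∈ G, t = stepVal ψ x) ∧ Disjoint G D)
  have hα : Hered α := fun t G H hH h => h.imp (fun h => ⟨hH.trans h.1, fiberOn_anti hH h.2⟩)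
    fun h => ⟨fun x hx => h.1 x (hH hx), h.2.mono_left hH⟩
  have hαloc : Loc S (fun t x => (t, x) ∈ spliced 𝒜 A ψ D) α := by
    have h1 := (Loc.and hS h𝒜.loc hA (hered_fiberOn 𝒜) fun _ _ _ hH h => Decides.anti hH h).mono
      (P' := fun y x => x ∈ A ∧ (y, x) ∈ 𝒜) (R' := α)
      (fun y x h => ⟨h.2, trivial⟩) fun y x G hx hxG hG => Or.inl ⟨hG.2.subset hxG hx.1, hG.1⟩
    have h2 := (Loc.and hS (loc_resolves (Y := ℝ) hS hψ) hD
      (fun _ _ _ hH h => Resolves.anti hH h) fun _ _ _ hH h => Decides.anti hH h).mono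
      (P' := fun y x => y = stepVal ψ x ∧ x ∉ D) (R' := α)
      (fun y x h => ⟨trivial, trivial⟩) fun y x G hx hxG hG =>
        Or.inr ⟨fun z hz => hx.1.trans (hG.1.eq hxG hz), hG.2.disjoint hxG hx.2⟩
    exact (h1.or h2).mono (fun _ _ h => h) fun _ _ _ _ _ h => h.elim id id
  let γ : Set X → Prop := fun G => (∃ l, G ⊆ B l) ∨ ∀ x ∈ G, stepVal φ x = 0 ∧ stepVal ψ x = 0
  have hγ : ∀ G H, H ⊆ G → γ G → γ H := fun G H hH h =>
    h.imp (fun ⟨l, hl⟩ => ⟨l, hH.trans hl⟩) fun h x hx => h x (hH hx)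
  have hγloc : Loc S (fun (_ : Unit) _ => True) (fun _ G => γ G) := by
    have h1 : Loc S (fun (_ : Unit) x => x ∈ ⋃ l, B l) (fun _ G => ∃ l, G ⊆ B l) :=
      Loc.of_countable (Set.range B) (Set.range_subset_iff.2 hB) (Set.countable_range B)
        fun x _ hx => by
          obtain ⟨l, hl⟩ := Set.mem_iUnion.1 hx
          exact ⟨B l, ⟨l, rfl⟩, hl, l, subset_rfl⟩
    have h2 : Loc S (fun (_ : Unit) x => x ∉ ⋃ l, B l)
        (fun _ G => ∀ x ∈ G, stepVal φ x = 0 ∧ stepVal ψ x = 0) := by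
      refine (Loc.and hS (loc_resolves (Y := Unit) hS hφ) (loc_resolves (Y := Unit) hS hψ)
        (fun _ _ _ hH h => Resolves.anti hH h) fun _ _ _ hH h => Resolves.anti hH h).mono
        (fun _ _ _ => ⟨trivial, trivial⟩) ?_
      intro _ x G hx hxG hG w hw
      rw [← hG.1.eq hxG hw, ← hG.2.eq hxG hw]
      exact ⟨stepVal_eq_zero fun E hE hxE => hx (hcov E (Finset.mem_union_left _ hE) hxE),
        stepVal_eq_zero fun E hE hxE => hx (hcov E (Finset.mem_union_right _ hE) hxE)⟩
    exact (h1.or h2).mono (fun _ x _ => em (x ∈ ⋃ l, B l)) fun _ _ _ _ _ h => h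
  let Q : Set X → Prop := fun G => (∃ i ∈ I, G ⊆ E i ∧ α (y i) G ∧ α (z i) G) ∧
    Resolves φ G ∧ Resolves ψ G ∧ Decides A G ∧ γ G
  have hloc : Loc S (fun (_ : Unit) x => ∃ i ∈ I, x ∈ E i) (fun _ G => Q G) := by
    have h1 : Loc S (fun (_ : Unit) x => ∃ i : I, x ∈ E i)
        (fun _ G => ∃ i ∈ I, G ⊆ E i ∧ α (y i) G ∧ α (z i) G) := by
      refine Loc.exists fun i => ?_
      have h0 : Loc S (fun (_ : Unit) x => x ∈ E i) (fun _ G => G ⊆ E i) :=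
        Loc.of_countable {E i} (by simpa using hE i i.2) (Set.countable_singleton _)
          fun x _ hx => ⟨E i, rfl, hx, subset_rfl⟩
      refine (Loc.and hS h0 (Loc.and hS (hαloc.comap fun _ : Unit => y i)
        (hαloc.comap fun _ : Unit => z i) (fun _ => hα _) fun _ => hα _)
        (fun _ _ _ hH h => hH.trans h)
        fun _ _ _ hH h => ⟨hα _ _ _ hH h.1, hα _ _ _ hH h.2⟩).mono ?_ ?_
      · exact fun _ x hx => ⟨hx, hy i i.2 x hx, hz i i.2 x hx⟩
      · exact fun _ x G _ _ h => ⟨i, i.2, h⟩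
    refine (Loc.and hS h1 (Loc.and hS (loc_resolves hS hφ) (Loc.and hS (loc_resolves hS hψ)
      (Loc.and hS (hA.comap fun _ => (0 : ℝ)) hγloc (fun _ _ _ hH h => Decides.anti hH h)
        fun _ _ _ hH h => hγ _ _ hH h)
        (fun _ _ _ hH h => Resolves.anti hH h)
        fun _ _ _ hH h => ⟨h.1.anti hH, hγ _ _ hH h.2⟩)
        (fun _ _ _ hH h => Resolves.anti hH h)
        fun _ _ _ hH h => ⟨h.1.anti hH, h.2.1.anti hH, hγ _ _ hH h.2.2⟩) ?_ ?_).mono ?_ ?_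
    · rintro _ G H hH ⟨i, hi, h⟩
      exact ⟨i, hi, hH.trans h.1, hα _ _ _ hH h.2.1, hα _ _ _ hH h.2.2⟩
    · exact fun _ _ _ hH h =>
        ⟨h.1.anti hH, h.2.1.anti hH, h.2.2.1.anti hH, hγ _ _ hH h.2.2.2⟩
    · rintro _ x ⟨i, hi, hx⟩
      exact ⟨⟨⟨i, hi⟩, hx⟩, trivial, trivial, trivial, trivial⟩
    · exact fun _ _ _ _ _ h => h
  refine preInt_mem_of_loc hS hμ (sum_single_mem_supported hE _) hU' (Q := Q) ?_ hloc ?_ ?_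
  · rintro G H hH ⟨⟨i, hi, h⟩, h2⟩
    exact ⟨⟨i, hi, hH.trans h.1, hα _ _ _ hH h.2.1, hα _ _ _ hH h.2.2⟩,
      h2.1.anti hH, h2.2.1.anti hH, h2.2.2.1.anti hH, hγ _ _ hH h2.2.2.2⟩
  · intro F hF x hx
    obtain ⟨i, hi, rfl⟩ := mem_of_mem_support_sum_single hF
    exact ⟨i, hi, hx⟩
  intro ι J G e hG hne hGd hQ hev
  choose w hw using hne
  choose k hkI hGE hαy hαz using fun i => (hQ i).1
  have htail : ∀ J' ⊆ J, (∀ i ∈ J', G i ⊆ A ∧ Disjoint (G i) D) →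
      ∑ i ∈ J', (stepVal φ (w i) - stepVal ψ (w i)) • μ (G i) ∈ T := by
    intro J' _ hJ'
    have hz : ∀ i ∈ J', (¬ ∃ l, G i ⊆ B l) →
        (stepVal φ (w i) - stepVal ψ (w i)) • μ (G i) = 0 := by
      intro i _ hi
      have := ((hQ i).2.2.2.2.resolve_left hi) (w i) (hw i)
      rw [this.1, this.2, sub_zero, zero_smul]
    rw [← Finset.sum_filter_add_sum_filter_not J' (fun i => ∃ l, G i ⊆ B l),
      Finset.sum_eq_zero (s := J'.filter fun i => ¬ ∃ l, G i ⊆ B l)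
        (fun i hi => hz i (Finset.mem_filter.1 hi).1 (Finset.mem_filter.1 hi).2), add_zero]
    have hfam := hK.family (J := (J'.filter fun i => ∃ l, G i ⊆ B l).attach)
      (A := fun i => G i) (l := fun i => (Finset.mem_filter.1 i.2).2.choose)
      (fun i _ => hG i) (fun i _ j _ hij => hGd fun h => hij (Subtype.ext h))
      (fun i _ => (Finset.mem_filter.1 i.2).2.choose_spec) (fun i _ hiK => by
        have hi := Finset.mem_filter.1 i.2
        have h1 := hJ' i hi.1
        exact Set.disjoint_left.1 h1.2 (hw i)
          (hDK _ hiK _ (hi.2.choose_spec (hw i)) (h1.1 (hw i))))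
    rw [← Finset.sum_attach]
    convert hfam using 2 with i
    rw [hdv _ _ ((Finset.mem_filter.1 i.2).2.choose_spec (hw i))]
  let good : ℝ → Set X → Prop := fun t G => G ⊆ A ∧ t ∈ fiberOn 𝒜 G
  let y' : ι → ℝ := fun i => if good (y (k i)) (G i) then y (k i) else stepVal φ (w i)
  let z' : ι → ℝ := fun i => if good (z (k i)) (G i) then z (k i) else stepVal φ (w i)
  have hφG : ∀ i, stepVal φ (w i) ∈ fiberOn 𝒜 (G i) := fun i x hx => by
    rw [(hQ i).2.1.eq (hw i) hx]; exact hφ𝒜 x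
  have h1 := hU ι J G y' z' (fun i _ => hG i) (fun i _ j _ hij => hGd hij)
    (fun i _ => by by_cases h : good (y (k i)) (G i) <;> simp only [y', h, if_true, if_false]
                   exacts [h.2, hφG i])
    (fun i _ => by by_cases h : good (z (k i)) (G i) <;> simp only [z', h, if_true, if_false]
                   exacts [h.2, hφG i])
  have h2 := htail (J.filter fun i => G i ⊆ A ∧ ¬ good (y (k i)) (G i)) (Finset.filter_subset _ _)
    fun i hi => by
      have := (Finset.mem_filter.1 hi).2
      exact ⟨this.1, ((hαy i).resolve_left this.2).2⟩
  have h3 := htail (J.filter fun i => G i ⊆ A ∧ ¬ good (z (k i)) (G i)) (Finset.filter_subset _ _)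
    fun i hi => by
      have := (Finset.mem_filter.1 hi).2
      exact ⟨this.1, ((hαz i).resolve_left this.2).2⟩
  have h4 := hUT _ h1 _ h2 _ h3
  rw [Finset.sum_filter, Finset.sum_filter, ← Finset.sum_sub_distrib,
    ← Finset.sum_add_distrib] at h4
  convert h4 using 2 with i
  have he : e i = y (k i) - z (k i) := by
    rw [← hev i (w i) (hw i), stepVal_sum_single_of_mem hEd _ (hkI i) (hGE i (hw i))]
  rw [he]
  have hyv : ¬ good (y (k i)) (G i) → y (k i) = stepVal ψ (w i) := fun h =>
    ((hαy i).resolve_left h).1 _ (hw i)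
  have hzv : ¬ good (z (k i)) (G i) → z (k i) = stepVal ψ (w i) := fun h =>
    ((hαz i).resolve_left h).1 _ (hw i)
  by_cases hGA : G i ⊆ A
  · by_cases hgy : good (y (k i)) (G i) <;> by_cases hgz : good (z (k i)) (G i) <;>
      simp only [y', z', hgy, hgz, hGA, if_true, if_false, true_and, not_true_eq_false,
        not_false_eq_true, ← sub_smul, ← add_smul, sub_zero, add_zero]
    · rw [hzv hgz]; ring_nf
    · rw [hyv hgy]; ring_nf
    · rw [hyv hgy, hzv hgz]; ring_nf
  · have hgy : ¬ good (y (k i)) (G i) := fun h => hGA h.1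
    have hgz : ¬ good (z (k i)) (G i) := fun h => hGA h.1
    simp [y', z', good, hGA, hyv hgy, hzv hgz]

end Splice

/-! ### Chains of neighbourhoods of zero -/

section NhdChain

variable {W : Type*} [AddCommGroup W] [Module ℝ W] [TopologicalSpace W]

/-- A base of closed convex symmetric neighbourhoods of `0` each of which contains the sum of the
next one with itself. -/
structure NhdChain (τ : ℕ → Set W) : Prop where
  mem_nhds : ∀ n, τ n ∈ 𝓝 (0 : W)
  isClosed : ∀ n, IsClosed (τ n)
  convex : ∀ n, Convex ℝ (τ n)
  neg : ∀ n, ∀ x ∈ τ n, -x ∈ τ n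
  add : ∀ n, ∀ x ∈ τ (n + 1), ∀ y ∈ τ (n + 1), x + y ∈ τ n
  basis : ∀ V ∈ 𝓝 (0 : W), ∃ n, τ n ⊆ V

variable {τ : ℕ → Set W}

theorem NhdChain.zero_mem (h : NhdChain τ) (n : ℕ) : (0 : W) ∈ τ n :=
  mem_of_mem_nhds (h.mem_nhds n)

theorem NhdChain.sub (h : NhdChain τ) {n : ℕ} {x y : W} (hx : x ∈ τ (n + 1))
    (hy : y ∈ τ (n + 1)) : x - y ∈ τ n :=
  sub_eq_add_neg x y ▸ h.add n x hx _ (h.neg _ y hy)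

theorem NhdChain.antitone (h : NhdChain τ) : Antitone τ :=
  antitone_nat_of_succ_le fun n x hx => add_zero x ▸ h.add n x hx 0 (h.zero_mem _)

/-- The analogue of ∑ 2^(-n-1) over n ≥ m being 2^(-m): the first term lies in τ (m + 1), and
inductively so does the sum of all later ones. -/
theorem NhdChain.sum_mem (h : NhdChain τ) (F : Finset ℕ) {m : ℕ} {v : ℕ → W}
    (hF : ∀ n ∈ F, m ≤ n) (hv : ∀ n ∈ F, v n ∈ τ (n + 1)) : ∑ n ∈ F, v n ∈ τ m := by
  classical
  have key : ∀ k m, ∀ u : ℕ → W, (∀ n, u n ∈ τ (n + 1)) →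
      ∑ n ∈ Finset.Ico m (m + k), u n ∈ τ m := by
    intro k
    induction k with
    | zero => intro m u _; simpa using h.zero_mem m
    | succ k ih =>
      intro m u hu
      rw [Finset.sum_eq_sum_Ico_succ_bot (by omega)]
      refine h.add m _ (hu m) _ ?_
      have := ih (m + 1) u hu
      rwa [show m + 1 + k = m + (k + 1) by omega] at this
  have := key (F.sup id + 1) m (fun n => if n ∈ F then v n else 0) fun n => by
    by_cases hn : n ∈ F
    · simpa [hn] using hv n hn
    · simpa [hn] using h.zero_mem _
  convert this using 1
  rw [← Finset.sum_filter]
  refine Finset.sum_congr ?_ fun _ _ => rfl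
  ext n
  simp only [Finset.mem_filter, Finset.mem_Ico]
  constructor
  · intro hn
    have : n ≤ F.sup id := Finset.le_sup (f := id) hn
    exact ⟨⟨hF n hn, by omega⟩, hn⟩
  · exact fun hn => hn.2

theorem NhdChain.sum_mem_shift {τ : ℕ → Set W} (h : NhdChain τ) (F : Finset ℕ) {m : ℕ} {v : ℕ → W}
    (hv : ∀ n ∈ F, v n ∈ τ (n + m + 1)) : ∑ n ∈ F, v n ∈ τ m := by
  have := h.sum_mem (F.map (addRightEmbedding m)) (m := m) (v := fun k => v (k - m))
    (fun n hn => by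
      obtain ⟨k, -, rfl⟩ := Finset.mem_map.1 hn
      simp)
    (fun n hn => by
      obtain ⟨k, hk, rfl⟩ := Finset.mem_map.1 hn
      simpa using hv k hk)
  simpa using this

variable [IsTopologicalAddGroup W] [ContinuousSMul ℝ W] [LocallyConvexSpace ℝ W]

theorem exists_closed_convex_nhd {V : Set W} (hV : V ∈ 𝓝 (0 : W)) :
    ∃ U ∈ 𝓝 (0 : W), IsClosed U ∧ Convex ℝ U ∧ (∀ x ∈ U, -x ∈ U) ∧ U ⊆ V ∧
      ∀ x ∈ U, ∀ y ∈ U, x + y ∈ V := by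
  obtain ⟨V', hV', hVV⟩ := exists_nhds_zero_half hV
  obtain ⟨V'', hV'', hcl, hsub⟩ := exists_mem_nhds_isClosed_subset hV'
  obtain ⟨C, ⟨hC, hCa⟩, hCV⟩ := (nhds_hasBasis_absConvex ℝ W).mem_iff.1 hV''
  have hCV' : closure C ⊆ V' := (closure_minimal hCV hcl).trans hsub
  refine ⟨closure C, Filter.mem_of_superset hC subset_closure, isClosed_closure, hCa.2.closure,
    fun x hx => ?_, fun x hx => ?_, fun x hx y hy => hVV x (hCV' hx) y (hCV' hy)⟩
  · exact hCa.1.closure.neg_mem_iff.2 hx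
  · simpa using hVV x (hCV' hx) 0 (mem_of_mem_nhds hV')

/-- The form u - t + t' is the error arising in `small_spliced`; t' = 0 covers plain differences. -/
theorem exists_closed_nhd_sub_add {U : Set W} (hU : U ∈ 𝓝 (0 : W)) :
    ∃ U' ∈ 𝓝 (0 : W), ∃ C ⊆ U, IsClosed C ∧ ∀ u ∈ U', ∀ t ∈ U', ∀ t' ∈ U', u - t + t' ∈ C := by
  obtain ⟨C, hC, hCcl, -, -, hCU, -⟩ := exists_closed_convex_nhd hU
  obtain ⟨V, hV, -, -, -, -, hVC⟩ := exists_closed_convex_nhd hC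
  obtain ⟨V', hV', -, -, hneg, hVV, hV'V⟩ := exists_closed_convex_nhd hV
  exact ⟨V', hV', C, hCU, hCcl, fun u hu t ht t' ht' => hVC _
    (sub_eq_add_neg u t ▸ hV'V u hu _ (hneg t ht)) _ (hVV ht')⟩

theorem exists_nhdChain [FirstCountableTopology W] {T : Set W} (hT : T ∈ 𝓝 (0 : W)) :
    ∃ τ : ℕ → Set W, NhdChain τ ∧ τ 0 ⊆ T := by
  obtain ⟨V, hV⟩ := (𝓝 (0 : W)).exists_antitone_basis
  have step : ∀ A : {A : Set W // A ∈ 𝓝 (0 : W)}, ∀ n : ℕ, ∃ U : {A : Set W // A ∈ 𝓝 (0 : W)},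
      IsClosed U.1 ∧ Convex ℝ U.1 ∧ (∀ x ∈ U.1, -x ∈ U.1) ∧ U.1 ⊆ A.1 ∩ V n ∧
        ∀ x ∈ U.1, ∀ y ∈ U.1, x + y ∈ A.1 ∩ V n := by
    intro A n
    obtain ⟨U, hU, h⟩ := exists_closed_convex_nhd
      (Filter.inter_mem A.2 (hV.1.mem_of_mem trivial : V n ∈ 𝓝 (0 : W)))
    exact ⟨⟨U, hU⟩, h⟩
  choose F hF using step
  let τ : ℕ → {A : Set W // A ∈ 𝓝 (0 : W)} := fun n =>
    Nat.rec (F ⟨T, hT⟩ 0) (fun n A => F A (n + 1)) n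
  have hτ : ∀ n, ∃ A m, τ n = F A m ∧ n ≤ m := by
    intro n
    cases n with
    | zero => exact ⟨_, _, rfl, le_rfl⟩
    | succ n => exact ⟨_, _, rfl, le_rfl⟩
  refine ⟨fun n => (τ n).1, ⟨fun n => (τ n).2, fun n => ?_, fun n => ?_, fun n => ?_, fun n => ?_,
    fun A hA => ?_⟩, ?_⟩
  · obtain ⟨A, m, h, -⟩ := hτ n
    rw [h]; exact (hF A m).1
  · obtain ⟨A, m, h, -⟩ := hτ n
    rw [h]; exact (hF A m).2.1
  · obtain ⟨A, m, h, -⟩ := hτ n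
    rw [h]; exact (hF A m).2.2.1
  · exact fun x hx y hy => ((hF (τ n) (n + 1)).2.2.2.2 x hx y hy).1
  · obtain ⟨n, -, hn⟩ := hV.1.mem_iff.1 hA
    obtain ⟨A, m, h, hm⟩ := hτ n
    refine ⟨n, ?_⟩
    rw [h]
    exact ((hF A m).2.2.2.1.trans Set.inter_subset_right).trans ((hV.2 hm).trans hn)
  · exact (hF ⟨T, hT⟩ 0).2.2.2.1.trans Set.inter_subset_left

end NhdChain

/-! ### Integrability as approximability -/

section Approximable

variable {X : Type*} {S : Set (Set X)} {W : Type*} [AddCommGroup W] [Module ℝ W]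
  [TopologicalSpace W]

/-- `g` is approximated by envelopes whose values have small differences. -/
def Approximable (S : Set (Set X)) (μ : Set X → W) (g : X → ℝ) : Prop :=
  ∀ U ∈ 𝓝 (0 : W), ∃ (𝒜 : Set (ℝ × X)) (φ : Set X →₀ ℝ), IsGen S 𝒜 ∧
    φ ∈ Finsupp.supported ℝ ℝ S ∧ Approximates 𝒜 (stepVal φ) ∧ Approximates 𝒜 g ∧ Small S μ 𝒜 U

variable [IsTopologicalAddGroup W] [ContinuousSMul ℝ W] [LocallyConvexSpace ℝ W]

theorem IsIntegrable.approximable (hS : IsIntervalSystem S) {μ : Set X → W}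
    (hμ : IsMeasureOn S μ) {f : X → ℝ} (hf : IsIntegrable S μ f) : Approximable S μ f := by
  intro U hU
  obtain ⟨a, ha⟩ := hf
  obtain ⟨U', hU', C, hCU, hC, h⟩ := exists_closed_nhd_sub_add hU
  obtain ⟨𝒜, h𝒜, hf𝒜, hsub⟩ := ha U' hU'
  obtain ⟨φ, hφ, hφ𝒜⟩ := h𝒜.exists_step
  refine ⟨𝒜, φ, h𝒜.isGen hS, hφ, hφ𝒜, hf𝒜,
    (small_of_bilinearSum hS hμ hφ hφ𝒜 hsub hC ?_).mono hCU⟩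
  rintro _ ⟨_, rfl, u, hu, rfl⟩ _ ⟨_, rfl, v, hv, rfl⟩
  have := h u hu v hv 0 (mem_of_mem_nhds hU')
  simpa using this

end Approximable

/-! ### Chains of envelopes, restriction and existence of integrals -/

section Chains

variable {X : Type*} {S : Set (Set X)} {W : Type*} [AddCommGroup W] [Module ℝ W]
  [UniformSpace W] [IsUniformAddGroup W] [CompleteSpace W] [ContinuousSMul ℝ W]

/-- Near each point of A, the value of g is admissible for 𝒜 and ℬ, so a countable partition has a
common admissible value on every piece meeting A. Only finitely many pieces can be used: ψ is
changed to the common values on those in K, where K is so large that the semivariation of φ - ψ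
beyond it stays in T. Elsewhere ψ is retained, and its graph off D is added to the envelope. -/
theorem exists_splice (hS : IsIntervalSystem S) {μ : Set X → W} (hμ : IsMeasureOn S μ)
    {𝒜 : Set (ℝ × X)} (h𝒜 : IsGen S 𝒜) {φ ψ : Set X →₀ ℝ}
    (hφ : φ ∈ Finsupp.supported ℝ ℝ S) (hφ𝒜 : Approximates 𝒜 (stepVal φ))
    (hψ : ψ ∈ Finsupp.supported ℝ ℝ S) {U T U' : Set W} (hU : Small S μ 𝒜 U) (hU' : IsClosed U')
    (hT : T ∈ 𝓝 (0 : W))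
    (hUT : ∀ u ∈ U, ∀ t ∈ T, ∀ t' ∈ T, u - t + t' ∈ U') {A : Set X}
    (hA : Loc S (fun (_ : ℝ) _ => True) (fun _ G => Decides A G)) {g : X → ℝ}
    (hg : ∀ x ∈ A, (g x, x) ∈ 𝒜) (hg' : ∀ x ∉ A, g x = stepVal ψ x) {ℬ : Set (ℝ × X)}
    (hℬ : Loc S (fun y x => (y, x) ∈ ℬ) (fun y G => y ∈ fiberOn ℬ G))
    (hgℬ : ∀ x ∈ A, (g x, x) ∈ ℬ) :
    ∃ (𝒜' : Set (ℝ × X)) (φ' : Set X →₀ ℝ), IsGen S 𝒜' ∧ φ' ∈ Finsupp.supported ℝ ℝ S ∧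
      Approximates 𝒜' (stepVal φ') ∧ Approximates 𝒜' g ∧
      (∀ x, (stepVal φ' x, x) ∈ ℬ ∨ stepVal φ' x = stepVal ψ x) ∧ Small S μ 𝒜' U' := by
  classical
  let R : Set X → Prop := fun G =>
    Disjoint G A ∨ ∃ y, y ∈ fiberOn 𝒜 G ∧ y ∈ fiberOn ℬ G
  let Q : Set X → Prop := fun G => Resolves φ G ∧ Resolves ψ G ∧ Decides A G ∧ R G
  have hR : ∀ G H, H ⊆ G → R G → R H := fun G H hH h =>
    h.imp (fun h => h.mono_left hH) fun ⟨y, h⟩ => ⟨y, fiberOn_anti hH h.1, fiberOn_anti hH h.2⟩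
  have hQ : ∀ G H, H ⊆ G → Q G → Q H := fun G H hH h =>
    ⟨h.1.anti hH, h.2.1.anti hH, h.2.2.1.anti hH, hR _ _ hH h.2.2.2⟩
  have hRloc : Loc S (fun (_ : Unit) _ => True) (fun _ G => R G) := by
    have h1 := (Loc.and hS h𝒜.loc hℬ (hered_fiberOn 𝒜) (hered_fiberOn ℬ)).exists_value
      (p := fun x => x ∈ A) fun x hx => ⟨g x, hg x hx, hgℬ x hx⟩
    have h2 : Loc S (fun (_ : Unit) x => x ∉ A) (fun _ G => Disjoint G A) :=
      (hA.comap fun _ : Unit => (0 : ℝ)).mono (fun _ _ _ => trivial)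
        fun _ x G hx hxG h => h.disjoint hxG hx
    exact (h2.or h1).mono (fun _ x _ => (em (x ∈ A)).symm) fun _ _ _ _ _ h => h
  have hloc : Loc S (fun (_ : Unit) _ => True) (fun _ G => Q G) :=
    (Loc.and hS (loc_resolves hS hφ) (Loc.and hS (loc_resolves hS hψ)
      (Loc.and hS (hA.comap fun _ => (0 : ℝ)) hRloc (fun _ _ _ hH h => Decides.anti hH h)
        fun _ _ _ hH h => hR _ _ hH h)
        (fun _ _ _ hH h => Resolves.anti hH h)
        fun _ _ _ hH h => ⟨h.1.anti hH, hR _ _ hH h.2⟩)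
        (fun _ _ _ hH h => Resolves.anti hH h)
        fun _ _ _ hH h => ⟨h.1.anti hH, h.2.1.anti hH, hR _ _ hH h.2.2⟩).mono
      (fun _ _ _ => ⟨trivial, trivial, trivial, trivial⟩) fun _ _ _ _ _ h => h
  obtain ⟨Λ, hΛ, B, hBS, hBne, hBd, hcov, hB⟩ := hloc.exists_partition hS (Q := Q) hQ
    (𝒱 := (φ.support ∪ ψ.support : Finset (Set X))) (by
      rw [Finset.coe_union]
      exact Set.union_subset ((Finsupp.mem_supported ℝ φ).1 hφ) ((Finsupp.mem_supported ℝ ψ).1 hψ))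
    (Finset.countable_toSet _) (fun _ _ => trivial)
  choose w hw using hBne
  have hcov' : ∀ E ∈ φ.support ∪ ψ.support, E ⊆ ⋃ l, B l := fun E hE x hx => hcov ⟨E, hE, hx⟩
  have hdv : ∀ l, ∀ x ∈ B l, stepVal φ x - stepVal ψ x
      = stepVal φ (w l) - stepVal ψ (w l) := fun l x hx => by
    rw [(hB l).1.eq hx (hw l), (hB l).2.1.eq hx (hw l)]
  have hsupp : ∀ E ∈ (φ - ψ).support, E ∈ φ.support ∪ ψ.support := fun E hE =>
    Finsupp.support_sub hE
  obtain ⟨K, hK⟩ := exists_svSums_tail hS hμ hBS (fun l => ⟨w l, hw l⟩) hBd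
    (Submodule.sub_mem _ hφ hψ)
    (fun l E hE => (Finset.mem_union.1 (hsupp E hE)).elim ((hB l).1 E) ((hB l).2.1 E))
    (fun E hE => hcov' E (hsupp E hE))
    (d := fun l => stepVal φ (w l) - stepVal ψ (w l))
    (fun l x hx => by rw [map_sub, Pi.sub_apply]; exact hdv l x hx) hT
  -- Pieces off A need no change, as g equals ψ there.
  let K' := K.filter fun l => ¬ Disjoint (B l) A
  have hy : ∀ l, ∃ y, ¬ Disjoint (B l) A → y ∈ fiberOn 𝒜 (B l) ∧ y ∈ fiberOn ℬ (B l) := by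
    intro l
    by_cases h : Disjoint (B l) A
    · exact ⟨0, fun h' => absurd h h'⟩
    · obtain ⟨y, hy⟩ := (hB l).2.2.2.resolve_left h
      exact ⟨y, fun _ => hy⟩
  choose y hy using hy
  have hK' : ∀ l ∈ K', ¬ Disjoint (B l) A := fun l hl => (Finset.mem_filter.1 hl).2
  have hKA : ∀ l ∈ K', B l ⊆ A := fun l hl => (hB l).2.2.1.resolve_right (hK' l hl)
  let D : Set X := ⋃ l ∈ K', B l
  have hD : Loc S (fun (_ : ℝ) _ => True) (fun _ G => Decides D G) := by
    refine (loc_decides_finset hS K' fun l _ => hBS l).mono (fun _ _ h => h) ?_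
    intro _ x G _ hxG hG
    by_cases hx : x ∈ D
    · obtain ⟨l, hl, hxl⟩ := Set.mem_iUnion₂.1 hx
      exact Or.inl (((hG l hl).subset hxG hxl).trans (Set.subset_biUnion_of_mem (u := B) hl))
    · refine Or.inr (Set.disjoint_iUnion₂_right.2 fun l hl => ?_)
      exact (hG l hl).disjoint hxG fun hxl => hx (Set.mem_biUnion (Finset.mem_coe.2 hl) hxl)
  refine ⟨spliced 𝒜 A ψ D,
    ψ + ∑ l ∈ K', Finsupp.single (B l) (y l - stepVal ψ (w l)), isGen_spliced hS h𝒜 hA hψ hD,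
    Submodule.add_mem _ hψ (sum_single_mem_supported (fun l _ => hBS l) _), ?_, ?_, ?_,
    small_spliced hS hμ h𝒜 hφ hφ𝒜 hψ hU hU' hUT hA hBS hcov' hdv hD ?_ hK⟩
  · refine approximates_modify (fun i _ j _ hij => hBd hij)
      (fun l _ x hx => (hB l).2.1.eq hx (hw l))
      (fun l hl x hx => Or.inl ⟨hKA l hl hx, (hy l (hK' l hl)).1 x hx⟩)
      (fun x hx => Or.inr ⟨rfl, fun hxD => ?_⟩)
    obtain ⟨l, hl, hxl⟩ := Set.mem_iUnion₂.1 hxD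
    exact hx l hl hxl
  · intro x
    by_cases hx : x ∈ A
    · exact Or.inl ⟨hx, hg x hx⟩
    · refine Or.inr ⟨hg' x hx, fun hxD => ?_⟩
      obtain ⟨l, hl, hxl⟩ := Set.mem_iUnion₂.1 hxD
      exact hx (hKA l hl hxl)
  · exact approximates_modify (𝒜 := {q | q ∈ ℬ ∨ q.1 = stepVal ψ q.2})
      (fun i _ j _ hij => hBd hij) (fun l _ x hx => (hB l).2.1.eq hx (hw l))
      (fun l hl x hx => Or.inl ((hy l (hK' l hl)).2 x hx)) fun x _ => Or.inr rfl
  · intro l hl x hx hxA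
    exact Set.mem_biUnion (Finset.mem_coe.2 (Finset.mem_filter.2
      ⟨hl, Set.not_disjoint_iff.2 ⟨x, hx, hxA⟩⟩)) hx

variable [LocallyConvexSpace ℝ W]

/-- A splice with the zero step-function; no second envelope is involved, so ℬ is everything. -/
theorem Approximable.indicator (hS : IsIntervalSystem S) {μ : Set X → W} (hμ : IsMeasureOn S μ)
    {f : X → ℝ} (hf : Approximable S μ f) {A : Set X} (hA : A ∈ S) :
    Approximable S μ (A.indicator f) := by
  intro U hU
  obtain ⟨U', hU', C, hCU, hC, h⟩ := exists_closed_nhd_sub_add hU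
  obtain ⟨𝒜, φ, h𝒜, hφ, hφ𝒜, hf𝒜, hsm⟩ := hf U' hU'
  obtain ⟨𝒜', φ', h1, h2, h3, h4, -, h5⟩ := exists_splice hS hμ h𝒜 hφ hφ𝒜
    (Submodule.zero_mem _) hsm hC hU' h (loc_decides hS hA) (g := A.indicator f)
    (fun x hx => by rw [Set.indicator_of_mem hx]; exact hf𝒜 x)
    (fun x hx => by rw [Set.indicator_of_notMem hx, map_zero, Pi.zero_apply])
    (ℬ := Set.univ) (Loc.of_forall fun _ _ _ _ => trivial) (fun _ _ => trivial)
  exact ⟨𝒜', φ', h1, h2, h3, h4, h5.mono hCU⟩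

/-- A sequence of envelopes with shrinking differences and of step-functions, each of which also
lies in the preceding envelope. -/
structure EnvChain (S : Set (Set X)) (μ : Set X → W) (f : X → ℝ) (τ : ℕ → Set W)
    (𝒜 : ℕ → Set (ℝ × X)) (φ : ℕ → Set X →₀ ℝ) : Prop where
  isGen : ∀ n, IsGen S (𝒜 n)
  supported : ∀ n, φ n ∈ Finsupp.supported ℝ ℝ S
  step_mem : ∀ n, Approximates (𝒜 n) (stepVal (φ n))
  succ_mem : ∀ n, Approximates (𝒜 n) (stepVal (φ (n + 1)))
  mem : ∀ n, Approximates (𝒜 n) f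
  small : ∀ n, Small S μ (𝒜 n) (τ n)

theorem Approximable.exists_envChain (hS : IsIntervalSystem S) {μ : Set X → W}
    (hμ : IsMeasureOn S μ) {f : X → ℝ} (hf : Approximable S μ f) {τ : ℕ → Set W}
    (hτ : ∀ n, τ n ∈ 𝓝 (0 : W)) : ∃ 𝒜 φ, EnvChain S μ f τ 𝒜 φ := by
  let Good : ℕ → Set (ℝ × X) × (Set X →₀ ℝ) → Prop := fun n q =>
    IsGen S q.1 ∧ q.2 ∈ Finsupp.supported ℝ ℝ S ∧ Approximates q.1 (stepVal q.2) ∧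
      Approximates q.1 f ∧ Small S μ q.1 (τ n)
  have h0 : ∃ q, Good 0 q := by
    obtain ⟨𝒜, φ, h⟩ := hf (τ 0) (hτ 0)
    exact ⟨(𝒜, φ), h⟩
  have hstep : ∀ n (q : {q // Good n q}), ∃ r : {r // Good (n + 1) r},
      Approximates q.1.1 (stepVal r.1.2) := by
    rintro n ⟨⟨ℬ, ψ⟩, hℬ, hψ, hψℬ, hfℬ, -⟩
    obtain ⟨U', hU', C, hCU, hC, h⟩ := exists_closed_nhd_sub_add (hτ (n + 1))
    obtain ⟨𝒜, φ, h𝒜, hφ, hφ𝒜, hf𝒜, hsm⟩ := hf U' hU'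
    -- With A the whole space, the new step-function takes values admissible for the previous
    -- envelope ℬ or agrees with ψ, which lies in ℬ too.
    obtain ⟨𝒜', φ', h1, h2, h3, h4, h5, h6⟩ := exists_splice hS hμ h𝒜 hφ hφ𝒜 hψ hsm hC hU' h
      (A := Set.univ) (Loc.of_forall fun _ _ => Or.inl (Set.subset_univ _)) (g := f)
      (fun x _ => hf𝒜 x) (fun x hx => absurd trivial hx) hℬ.loc (fun x _ => hfℬ x)
    refine ⟨⟨(𝒜', φ'), h1, h2, h3, h4, h6.mono hCU⟩, fun x => ?_⟩
    rcases h5 x with h | h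
    · exact h
    · dsimp only
      rw [h]
      exact hψℬ x
  obtain ⟨q0, hq0⟩ := h0
  choose F hF using hstep
  let q : ∀ n, {q // Good n q} := fun n => Nat.rec ⟨q0, hq0⟩ (fun n q => F n q) n
  exact ⟨fun n => (q n).1.1, fun n => (q n).1.2, fun n => (q n).2.1, fun n => (q n).2.2.1,
    fun n => (q n).2.2.2.1, fun n => hF n (q n), fun n => (q n).2.2.2.2.1,
    fun n => (q n).2.2.2.2.2⟩

/-- Consecutive pre-integrals in an `EnvChain` differ by elements of τ (n + 1), so they converge by
completeness. The bilinear sum of each envelope stays near its own pre-integral and hence near the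
limit. -/
theorem Approximable.isIntegrable [FirstCountableTopology W] (hS : IsIntervalSystem S)
    {μ : Set X → W} (hμ : IsMeasureOn S μ) {f : X → ℝ} (hf : Approximable S μ f) :
    IsIntegrable S μ f := by
  obtain ⟨τ, hτ, -⟩ := exists_nhdChain (W := W) Filter.univ_mem
  obtain ⟨𝒜, φ, h⟩ := hf.exists_envChain hS hμ (τ := fun n => τ (n + 1)) fun n => hτ.mem_nhds _
  let v : ℕ → W := fun n => preInt μ (φ (n + 1)) - preInt μ (φ n)
  have hv : ∀ n, v n ∈ τ (n + 1) := fun n => (h.small n).preInt_sub_mem hS hμ (hτ.isClosed _)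
    (h.supported _) (h.supported _) (h.succ_mem n) (h.step_mem n)
  have hsum : Summable v := by
    refine summable_iff_vanishing.2 fun e he => ?_
    obtain ⟨m, hm⟩ := hτ.basis e he
    refine ⟨Finset.range m, fun t ht => hm (hτ.sum_mem t (fun n hn => ?_) fun n _ => hv n)⟩
    by_contra hlt
    exact Finset.disjoint_left.1 ht hn (Finset.mem_range.2 (not_le.1 hlt))
  have hlim := hsum.hasSum.tendsto_sum_nat
  simp only [v, Finset.sum_range_sub (fun n => preInt μ (φ n))] at hlim
  set s := ∑' n, v n
  have hdiff : ∀ n, s + preInt μ (φ 0) - preInt μ (φ n) ∈ τ n := by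
    intro n
    have hl : Filter.Tendsto (fun m => preInt μ (φ m) - preInt μ (φ 0) + preInt μ (φ 0)
        - preInt μ (φ n)) Filter.atTop (𝓝 (s + preInt μ (φ 0) - preInt μ (φ n))) :=
      (hlim.add_const _).sub_const _
    refine (hτ.isClosed n).mem_of_tendsto hl (Filter.eventually_atTop.2 ⟨n, fun m hm => ?_⟩)
    rw [sub_add_cancel, ← Finset.sum_Ico_sub (fun n => preInt μ (φ n)) hm]
    exact hτ.sum_mem _ (fun k hk => (Finset.mem_Ico.1 hk).1) fun k _ => hv k
  refine ⟨s + preInt μ (φ 0), fun T hT => ?_⟩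
  obtain ⟨n, hn⟩ := hτ.basis T hT
  refine ⟨𝒜 (n + 1), (h.isGen _).isEnvelope hS (h.supported _) (h.step_mem _), h.mem _, ?_⟩
  intro w hw
  have hw' : w - preInt μ (φ (n + 1)) ∈ τ (n + 1) := by
    have : bilinearSum S μ (𝒜 (n + 1)) ⊆
        (fun w => w - preInt μ (φ (n + 1))) ⁻¹' τ (n + 1 + 1) := by
      refine bilinearSum_subset ((hτ.isClosed _).preimage (continuous_id.sub continuous_const)) ?_
      intro ψ hψ hψ𝒜
      exact (h.small _).preInt_sub_mem hS hμ (hτ.isClosed _) hψ (h.supported _) hψ𝒜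
        (h.step_mem _)
    exact hτ.antitone (Nat.le_succ _) (this hw)
  refine ⟨_, rfl, w - (s + preInt μ (φ 0)), hn ?_, by simp⟩
  have := hτ.sub hw' (hdiff (n + 1))
  convert this using 1
  abel

end Chains

/-! ### Convexity, domination and a Borel-Cantelli lemma -/

section Negligible

variable {W : Type*} [AddCommGroup W] [Module ℝ W]

/-- One coefficient at a time, θ is the convex combination of 1 and -1 with weights (1 + θ) / 2 and
(1 - θ) / 2; the offset a carries the coefficients already treated. -/
theorem Convex.sum_smul_mem_of_signs {T : Set W} (hT : Convex ℝ T) {ι : Type*} (J : Finset ι)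
    (w : ι → W) {θ : ι → ℝ} (hθ : ∀ i ∈ J, |θ i| ≤ 1) (a : W)
    (h : ∀ σ : ι → ℝ, (∀ i ∈ J, σ i = 1 ∨ σ i = -1) → a + ∑ i ∈ J, σ i • w i ∈ T) :
    a + ∑ i ∈ J, θ i • w i ∈ T := by
  classical
  induction J using Finset.induction_on generalizing a with
  | empty => simpa using h (fun _ => 1) (by simp)
  | insert i J hi ih =>
    have key : ∀ s : ℝ, s = 1 ∨ s = -1 → a + s • w i + ∑ j ∈ J, θ j • w j ∈ T := by
      intro s hs
      refine ih (fun j hj => hθ j (Finset.mem_insert_of_mem hj)) _ fun σ hσ => ?_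
      have := h (Function.update σ i s) fun j hj => by
        rcases Finset.mem_insert.1 hj with rfl | hj'
        · simpa using hs
        · have : j ≠ i := fun h => hi (h ▸ hj')
          simpa [this] using hσ j hj'
      rw [Finset.sum_insert hi, Function.update_self, ← add_assoc] at this
      convert this using 2
      refine Finset.sum_congr rfl fun j hj => ?_
      have : j ≠ i := fun h => hi (h ▸ hj)
      simp [this]
    have hb := abs_le.1 (hθ i (Finset.mem_insert_self i J))
    have := hT (key 1 (Or.inl rfl)) (key (-1) (Or.inr rfl)) (a := (1 + θ i) / 2)
      (b := (1 - θ i) / 2) (by linarith) (by linarith) (by ring)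
    rw [Finset.sum_insert hi]
    convert this using 1
    module

variable {X : Type*} {S : Set (Set X)}

/-- Interchanging y i and z i realises every choice of signs, and convexity fills in the smaller
coefficients. If y i = z i, then e i = 0, in accordance with the quotient by zero. -/
theorem Small.sum_mem_of_abs_le {μ : Set X → W} {𝒜 : Set (ℝ × X)} {U : Set W}
    (h : Small S μ 𝒜 U) (hU : Convex ℝ U) {ι : Type} {J : Finset ι} {B : ι → Set X}
    {y z e : ι → ℝ} (hB : ∀ i ∈ J, B i ∈ S) (hd : (J : Set ι).PairwiseDisjoint B)
    (hy : ∀ i ∈ J, y i ∈ fiberOn 𝒜 (B i)) (hz : ∀ i ∈ J, z i ∈ fiberOn 𝒜 (B i))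
    (he : ∀ i ∈ J, |e i| ≤ |y i - z i|) : ∑ i ∈ J, e i • μ (B i) ∈ U := by
  classical
  have key := Convex.sum_smul_mem_of_signs hU J (fun i => (y i - z i) • μ (B i))
    (θ := fun i => e i / (y i - z i)) (fun i hi => by
      rw [abs_div]
      exact div_le_one_of_le₀ (he i hi) (abs_nonneg _)) 0 fun σ hσ => by
    have := h ι J B (fun i => if σ i = 1 then y i else z i) (fun i => if σ i = 1 then z i else y i)
      hB hd (fun i hi => by split_ifs; exacts [hy i hi, hz i hi])
      (fun i hi => by split_ifs; exacts [hz i hi, hy i hi])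
    rw [zero_add]
    convert this using 1
    refine Finset.sum_congr rfl fun i hi => ?_
    by_cases h1 : σ i = 1
    · simp [h1]
    · rw [(hσ i hi).resolve_left h1, if_neg (by norm_num), if_neg (by norm_num)]
      module
  rw [zero_add] at key
  convert key using 1
  refine Finset.sum_congr rfl fun i hi => ?_
  by_cases h0 : y i - z i = 0
  · have : e i = 0 := by simpa [h0] using he i hi
    simp [this]
  · rw [smul_smul, div_mul_cancel₀ _ h0]

variable [TopologicalSpace W] [IsTopologicalAddGroup W] [ContinuousSMul ℝ W]

/-- A Borel-Cantelli lemma: divergence of differences of values allowed by a sequence of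
envelopes with small differences happens only on a negligible set. -/
theorem isNegligible_of_not_summable (hS : IsIntervalSystem S) {μ : Set X → W}
    (hμ : IsMeasureOn S μ) {τ : ℕ → Set W} (hτ : NhdChain τ) {𝒜 : ℕ → Set (ℝ × X)}
    (h𝒜 : ∀ n, IsGen S (𝒜 n)) (hsm : ∀ n, Small S μ (𝒜 n) (τ (n + 1))) {N : Set X}
    (hN : ∀ x ∈ N, ∃ u v : ℕ → ℝ, (∀ n, (u n, x) ∈ 𝒜 n ∧ (v n, x) ∈ 𝒜 n) ∧
      ¬ Summable fun n => |u n - v n|) : IsNegligible S μ N := by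
  classical
  intro T hT
  obtain ⟨m, hm⟩ := hτ.basis T hT
  -- The admissible values are those dominated by a finite variation starting at level m. Over N
  -- these variations are unbounded, so every real value is admitted; the start at m keeps the
  -- bilinear sum in τ m.
  let 𝒞 : Set (ℝ × X) := {q | ∃ (M : ℕ) (u v : ℕ → ℝ), (∀ n ∈ Finset.Ico m M, (u n, q.2) ∈ 𝒜 n ∧
    (v n, q.2) ∈ 𝒜 n) ∧ |q.1| ≤ ∑ n ∈ Finset.Ico m M, |u n - v n|}
  let R : ℝ → Set X → Prop := fun y G => ∃ (M : ℕ) (u v : ℕ → ℝ),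
    (∀ n ∈ Finset.Ico m M, u n ∈ fiberOn (𝒜 n) G ∧ v n ∈ fiberOn (𝒜 n) G) ∧
      |y| ≤ ∑ n ∈ Finset.Ico m M, |u n - v n|
  have hR : Hered R := fun y G H hH ⟨M, u, v, h, hy⟩ =>
    ⟨M, u, v, fun n hn => ⟨fiberOn_anti hH (h n hn).1, fiberOn_anti hH (h n hn).2⟩, hy⟩
  have hloc : Loc S (fun y x => (y, x) ∈ 𝒞) R := by
    refine Loc.exists (P := fun M y x => ∃ u v : ℕ → ℝ, (∀ n ∈ Finset.Ico m M, (u n, x) ∈ 𝒜 n ∧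
      (v n, x) ∈ 𝒜 n) ∧ |y| ≤ ∑ n ∈ Finset.Ico m M, |u n - v n|) fun M => ?_
    have h1 := loc_forall_finset hS (Finset.Ico m M) (Y := (ℕ → ℝ) × (ℕ → ℝ))
      (P := fun n q x => (q.1 n, x) ∈ 𝒜 n ∧ (q.2 n, x) ∈ 𝒜 n)
      (R := fun n q G => q.1 n ∈ fiberOn (𝒜 n) G ∧ q.2 n ∈ fiberOn (𝒜 n) G)
      (fun n _ q G H hH h => ⟨fiberOn_anti hH h.1, fiberOn_anti hH h.2⟩)
      fun n _ => Loc.and hS ((h𝒜 n).loc.comap fun q : (ℕ → ℝ) × (ℕ → ℝ) => q.1 n)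
        ((h𝒜 n).loc.comap fun q : (ℕ → ℝ) × (ℕ → ℝ) => q.2 n)
        (fun _ _ _ hH h => fiberOn_anti hH h) (fun _ _ _ hH h => fiberOn_anti hH h)
    refine h1.map ?_
    rintro y x ⟨u, v, huv, hy⟩
    exact ⟨(u, v), huv, fun G _ hG => ⟨M, u, v, hG, hy⟩⟩
  have hgen : IsGen S 𝒞 := by
    refine ⟨hloc.mono (fun _ _ h => h) ?_, ?_⟩
    · rintro y x G - - ⟨M, u, v, huv, hy⟩ z hz
      exact ⟨M, u, v, fun n hn => ⟨(huv n hn).1 z hz, (huv n hn).2 z hz⟩, hy⟩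
    · choose 𝒟 h𝒟S h𝒟 hoff using fun n => (h𝒜 n).supp
      refine ⟨⋃ n, 𝒟 n, Set.iUnion_subset h𝒟S, Set.countable_iUnion h𝒟, ?_⟩
      rintro x hx y ⟨M, u, v, huv, hy⟩
      have hx' : ∀ n, x ∉ ⋃₀ 𝒟 n := fun n ⟨D, hD, hxD⟩ =>
        hx ⟨D, Set.mem_iUnion.2 ⟨n, hD⟩, hxD⟩
      rw [Finset.sum_eq_zero fun n hn => by
        rw [hoff n x (hx' n) _ (huv n hn).1, hoff n x (hx' n) _ (huv n hn).2, sub_zero,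
          abs_zero]] at hy
      exact abs_nonpos_iff.1 hy
  have h0 : Approximates 𝒞 (fun _ => 0) := fun x => ⟨m, 0, 0, by simp, by simp⟩
  have h0' : Approximates 𝒞 (stepVal 0) := by rw [map_zero]; exact h0
  refine ⟨𝒞, ⟨hgen.isEnvelope hS (Submodule.zero_mem _) h0', h0⟩, ?_, ?_⟩
  · rintro ⟨y, x⟩ ⟨-, hx⟩
    obtain ⟨u, v, huv, hns⟩ := hN x hx
    have htend := (not_summable_iff_tendsto_nat_atTop_of_nonneg
      (f := fun n => |u n - v n|) fun n => abs_nonneg _).1 hns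
    obtain ⟨M, hM, hmM⟩ := ((htend.eventually_ge_atTop
      (|y| + ∑ n ∈ Finset.range m, |u n - v n|)).and (Filter.eventually_ge_atTop m)).exists
    refine ⟨M, u, v, fun n _ => huv n, ?_⟩
    rw [Finset.sum_Ico_eq_sub _ hmM]
    dsimp only
    linarith
  · refine (bilinearSum_subset (hτ.isClosed m) fun φ hφ hφ𝒞 => ?_).trans hm
    have hloc' : Loc S (fun (_ : Unit) _ => True)
        (fun _ G => Resolves φ G ∧ ∃ y, (∀ x ∈ G, stepVal φ x = y) ∧ R y G) := by
      refine (Loc.and hS (loc_resolves hS hφ) hloc (fun _ _ _ hH h => Resolves.anti hH h) hR).map ?_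
      intro _ x _
      exact ⟨stepVal φ x, ⟨trivial, hφ𝒞 x⟩, fun G hxG hG =>
        ⟨hG.1, _, fun z hz => hG.1.eq hz hxG, hG.2⟩⟩
    refine preInt_mem_of_loc hS hμ hφ (hτ.isClosed m) ?_ hloc' (fun _ _ _ _ => trivial) ?_
    · rintro G H hH ⟨h1, y, hy, h2⟩
      exact ⟨h1.anti hH, y, fun x hx => hy x (hH hx), hR _ _ _ hH h2⟩
    intro ι J B e hB hne hBd hQ hev
    choose w hw using hne
    have hex : ∀ i, R (e i) (B i) := by
      intro i
      obtain ⟨y, hy, h⟩ := (hQ i).2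
      rwa [← hy (w i) (hw i), hev i (w i) (hw i)] at h
    choose M u v huv hle using hex
    let s : ι → ℝ := fun i => ∑ n ∈ Finset.Ico m (M i), |u i n - v i n|
    -- The value e i is shared among the levels in proportion to their variations, so that each
    -- share is dominated by a difference admissible at its level. If s i = 0, then e i = 0.
    let t : ι → ℕ → ℝ := fun i n => e i * (|u i n - v i n| / s i)
    have hs : ∀ i, 0 ≤ s i := fun i => Finset.sum_nonneg fun n _ => abs_nonneg _
    have ht : ∀ i n, |t i n| ≤ |u i n - v i n| := by
      intro i n
      rcases (hs i).eq_or_lt with h | h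
      · simp [t, ← h]
      · rw [abs_mul, abs_div, abs_abs, abs_of_pos h, mul_div_left_comm]
        exact mul_le_of_le_one_right (abs_nonneg _) ((div_le_one h).2 (hle i))
    have hsum : ∀ i, e i = ∑ n ∈ Finset.Ico m (M i), t i n := by
      intro i
      rw [← Finset.mul_sum, ← Finset.sum_div]
      rcases (hs i).eq_or_lt with h | h
      · have : e i = 0 := abs_nonpos_iff.1 ((hle i).trans h.symm.le)
        simp [this]
      · rw [div_self h.ne', mul_one]
    have hswap : ∑ i ∈ J, e i • μ (B i) = ∑ n ∈ Finset.Ico m (J.sup M),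
        ∑ i ∈ J with n < M i, t i n • μ (B i) := by
      rw [Finset.sum_congr rfl fun i _ => by rw [hsum i, Finset.sum_smul]]
      refine Finset.sum_comm' fun i n => ?_
      simp only [Finset.mem_Ico, Finset.mem_filter]
      constructor
      · rintro ⟨hi, hmn, hn⟩
        exact ⟨⟨hi, hn⟩, hmn, hn.trans_le (Finset.le_sup hi)⟩
      · rintro ⟨⟨hi, hn⟩, hmn, -⟩
        exact ⟨hi, hmn, hn⟩
    rw [hswap]
    refine hτ.sum_mem _ (fun n hn => (Finset.mem_Ico.1 hn).1) fun n hn => ?_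
    have hmem : ∀ i ∈ J.filter (fun i => n < M i), n ∈ Finset.Ico m (M i) := fun i hi =>
      Finset.mem_Ico.2 ⟨(Finset.mem_Ico.1 hn).1, (Finset.mem_filter.1 hi).2⟩
    exact (hsm n).sum_mem_of_abs_le (hτ.convex _) (fun i _ => hB i)
      (fun i _ j _ hij => hBd hij) (fun i hi => (huv i n (hmem i hi)).1)
      (fun i hi => (huv i n (hmem i hi)).2) fun i _ => ht i n

end Negligible

/-! ### Tails of a sequence of levels -/

section SigmaTails

variable {W : Type*} [AddCommGroup W] [Module ℝ W] [TopologicalSpace W] {X : Type*}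
  {S : Set (Set X)} {μ : Set X → W}

/-- If the total contributions of the levels decrease along a chain of neighbourhoods and each
level has small tails, then the union of the levels has small tails. -/
theorem exists_svSums_tail_sigma {τ : ℕ → Set W} (hτ : NhdChain τ) {Λ : ℕ → Type}
    {c : ∀ n, Λ n → ℝ} {E : ∀ n, Λ n → Set X}
    (h : ∀ n, 0 < n → SvSums S μ (c n) (E n) (fun _ => True) (τ (n + 1)))
    (ht : ∀ n, ∀ T ∈ 𝓝 (0 : W), ∃ K : Finset (Λ n), SvSums S μ (c n) (E n) (fun l => l ∉ K) T)
    {T : Set W} (hT : T ∈ 𝓝 (0 : W)) :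
    ∃ Ξ : Finset (Σ n, Λ n),
      SvSums S μ (fun l : Σ n, Λ n => c l.1 l.2) (fun l => E l.1 l.2) (fun l => l ∉ Ξ) T := by
  classical
  obtain ⟨m, hm⟩ := hτ.basis T hT
  -- Levels up to m are truncated, with tails adding up to an element of τ (m + 1); later levels are
  -- kept whole and also add up within τ (m + 1). Level 0 is always truncated, so no bound on its
  -- total is required.
  choose K hK using fun n => ht n _ (hτ.mem_nhds (n + (m + 1) + 1))
  refine ⟨(Finset.range (m + 1)).sigma K, fun L v hp hv => hm ?_⟩
  have hlev : ∀ n, SvSums S μ (c n) (E n) (fun l => ⟨n, l⟩ ∉ (Finset.range (m + 1)).sigma K)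
      (if n < m + 1 then τ (n + (m + 1) + 1) else τ (n + 1)) := by
    intro n L v hp hv
    by_cases hn : n < m + 1
    · simp only [hn, if_true]
      exact hK n L v (fun l hl hlK =>
        hp l hl (Finset.mem_sigma.2 ⟨Finset.mem_range.2 hn, hlK⟩)) hv
    · simp only [hn, if_false]
      exact h n (by omega) L v (fun _ _ => trivial) hv
  obtain ⟨F, z, hz, hsum⟩ := SvSums.exists_sigma
    (p := fun l => l ∉ (Finset.range (m + 1)).sigma K) hlev hp hv
  rw [hsum, ← Finset.sum_filter_add_sum_filter_not F (fun n => n < m + 1)]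
  refine hτ.add m _ (hτ.sum_mem_shift _ fun n hn => ?_) _ (hτ.sum_mem _ (fun n hn => ?_)
    fun n hn => ?_)
  · simpa [(Finset.mem_filter.1 hn).2] using hz n
  · exact not_lt.1 (Finset.mem_filter.1 hn).2
  · simpa [(Finset.mem_filter.1 hn).2] using hz n

end SigmaTails

/-! ### From finite selections to closures of algebraic sums -/

section Sums

variable {W : Type*} [AddCommGroup W] [TopologicalSpace W] [IsTopologicalAddGroup W]

/-- A finite sum is continuous on the product, and the closure of a product is the product of the
closures. -/
theorem sum_mem_of_forall_mem_closure {ι : Type*} {J : Finset ι} {V : ι → Set W} {U : Set W}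
    (hU : IsClosed U) (h : ∀ v : ι → W, (∀ i ∈ J, v i ∈ V i) → ∑ i ∈ J, v i ∈ U) {v : ι → W}
    (hv : ∀ i ∈ J, v i ∈ closure (V i)) : ∑ i ∈ J, v i ∈ U := by
  have h1 : v ∈ closure ((J : Set ι).pi V) := by
    rw [closure_pi_set]
    exact fun i hi => hv i hi
  have h2 : Continuous fun v : ι → W => ∑ i ∈ J, v i :=
    continuous_finsetSum J fun i _ => continuous_apply i
  rw [← hU.closure_eq]
  exact map_mem_closure h2 h1 fun v hv => h v fun i hi => hv i hi

variable [Module ℝ W] {X : Type*} {S : Set (Set X)} {μ : Set X → W}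

theorem SvSums.sumSvarIn {Λ : Type} {c : Λ → ℝ} {E : Λ → Set X} {U : Set W} (hU : IsClosed U)
    (h : SvSums S μ c E (fun _ => True) U) : SumSvarIn S μ c E U := by
  refine closure_minimal ?_ hU
  rintro w ⟨a, ha, rfl⟩
  exact sum_mem_of_forall_mem_closure hU (fun v hv => h _ v (fun _ _ => trivial) hv)
    fun l _ => ha l

theorem svarTailsSmall_of_svSums {Λ : Type} {c : Λ → ℝ} {E : Λ → Set X}
    (h : ∀ T ∈ 𝓝 (0 : W), ∃ Ξ : Finset Λ, SvSums S μ c E (fun l => l ∉ Ξ) T) :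
    SvarTailsSmall S μ c E := by
  intro T hT
  obtain ⟨T', hT', hcl, hsub⟩ := exists_mem_nhds_isClosed_subset hT
  obtain ⟨Ξ, hΞ⟩ := h T' hT'
  exact ⟨Ξ, ((hΞ.comp Subtype.val_injective fun l => l.2).sumSvarIn hcl).trans hsub⟩

end Sums

/-! ### Comparing a constant with a local integral -/

section LocalIntegral

variable {X : Type*} {S : Set (Set X)} {W : Type*} [AddCommGroup W] [Module ℝ W]

/-- Sums of differences between `d` and values allowed by `𝒜` over finite disjoint families
in `A`. -/
def diffSums (S : Set (Set X)) (μ : Set X → W) (𝒜 : Set (ℝ × X)) (A : Set X) (d : ℝ) : Set W :=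
  {w | ∃ (ι : Type) (J : Finset ι) (G : ι → Set X) (y : ι → ℝ), (∀ i ∈ J, G i ∈ S) ∧
    (∀ i ∈ J, G i ⊆ A) ∧ (J : Set ι).PairwiseDisjoint G ∧ (∀ i ∈ J, y i ∈ fiberOn 𝒜 (G i)) ∧
    w = ∑ i ∈ J, (d - y i) • μ (G i)}

variable [TopologicalSpace W] [IsTopologicalAddGroup W] [ContinuousSMul ℝ W]
  [LocallyConvexSpace ℝ W]

/-- An envelope ℬ for the restricted function determines a up to a small error. On small pieces
there are values admissible for ℬ which inside A are also admissible for 𝒜 and outside A are 0.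
Imposing them on φ over a large finite K gives a pre-integral near a, and d • μ A is nearly its
partial sum over K; subtraction leaves an element of `diffSums`. -/
theorem smul_sub_integral_mem_closure (hS : IsIntervalSystem S) {μ : Set X → W}
    (hμ : IsMeasureOn S μ) {f : X → ℝ} {A : Set X} (hA : A ∈ S) {a : W}
    (ha : HasIntegral S μ (A.indicator f) a) {𝒜 : Set (ℝ × X)} (h𝒜 : IsGen S 𝒜)
    (hf : Approximates 𝒜 f) (d : ℝ) : d • μ A - a ∈ closure (diffSums S μ 𝒜 A d) := by
  classical
  suffices h : ∀ T ∈ 𝓝 (0 : W), ∃ w ∈ diffSums S μ 𝒜 A d, w - (d • μ A - a) ∈ T by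
    rw [mem_closure_iff_nhds]
    intro t ht
    have ht' : (fun v => v + (d • μ A - a)) ⁻¹' t ∈ 𝓝 (0 : W) := by
      refine (continuous_add_const _).continuousAt.preimage_mem_nhds ?_
      simpa using ht
    obtain ⟨w, hw, hwt⟩ := h _ ht'
    exact ⟨w, by simpa using hwt, hw⟩
  intro T hT
  obtain ⟨U, hU, C, hCT, -, hUC⟩ := exists_closed_nhd_sub_add hT
  obtain ⟨ℬ, hℬ, hfℬ, hsub⟩ := ha U hU
  obtain ⟨φ, hφ, hφℬ⟩ := hℬ.exists_step
  let R : Set X → Prop := fun G => ∃ y, y ∈ fiberOn ℬ G ∧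
    ((G ⊆ A ∧ y ∈ fiberOn 𝒜 G) ∨ (Disjoint G A ∧ y = 0))
  have hR : ∀ G H, H ⊆ G → R G → R H := fun G H hH ⟨y, h1, h2⟩ => ⟨y, fiberOn_anti hH h1,
    h2.imp (fun h => ⟨hH.trans h.1, fiberOn_anti hH h.2⟩) fun h => ⟨h.1.mono_left hH, h.2⟩⟩
  have hRloc : Loc S (fun (_ : Unit) _ => True) (fun _ G => R G) := by
    have h1 : Loc S (fun y x => ((y, x) ∈ 𝒜 ∧ x ∈ A) ∨ (y = 0 ∧ x ∉ A))
        (fun y G => (G ⊆ A ∧ y ∈ fiberOn 𝒜 G) ∨ (Disjoint G A ∧ y = 0)) := by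
      refine Loc.or ((Loc.and hS h𝒜.loc (loc_decides (Y := ℝ) hS hA) (hered_fiberOn 𝒜)
        fun _ _ _ hH h => Decides.anti hH h).mono (fun _ _ h => ⟨h.1, trivial⟩) ?_)
        ((loc_decides (Y := ℝ) hS hA).mono (fun _ _ _ => trivial) ?_)
      · exact fun y x G hx hxG hG => ⟨hG.2.subset hxG hx.2, hG.1⟩
      · exact fun y x G hx hxG hG => ⟨hG.disjoint hxG hx.2, hx.1⟩
    refine (Loc.and hS (hℬ.isGen hS).loc h1 (hered_fiberOn ℬ) ?_).exists_value ?_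
    · exact fun y G H hH h => h.imp (fun h => ⟨hH.trans h.1, fiberOn_anti hH h.2⟩)
        fun h => ⟨h.1.mono_left hH, h.2⟩
    · intro x _
      refine ⟨A.indicator f x, hfℬ x, ?_⟩
      by_cases hx : x ∈ A
      · exact Or.inl ⟨by rw [Set.indicator_of_mem hx]; exact hf x, hx⟩
      · exact Or.inr ⟨Set.indicator_of_notMem hx f, hx⟩
  have hloc : Loc S (fun (_ : Unit) _ => True)
      (fun _ G => Resolves φ G ∧ Decides A G ∧ R G) :=
    (Loc.and hS (loc_resolves hS hφ) (Loc.and hS (loc_decides hS hA) hRloc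
      (fun _ _ _ hH h => Decides.anti hH h) fun _ _ _ hH h => hR _ _ hH h)
      (fun _ _ _ hH h => Resolves.anti hH h) fun _ _ _ hH h => ⟨h.1.anti hH, hR _ _ hH h.2⟩).mono
      (fun _ _ _ => ⟨trivial, trivial, trivial⟩) fun _ _ _ _ _ h => h
  -- The partition has to cover A too, because μ A is expanded along it.
  obtain ⟨Λ, hΛ, B, hBS, hBne, hBd, hcov, hB⟩ := hloc.exists_partition hS
    (Q := fun G => Resolves φ G ∧ Decides A G ∧ R G)
    (fun G H hH h => ⟨h.1.anti hH, h.2.1.anti hH, hR _ _ hH h.2.2⟩)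
    (𝒱 := insert A (φ.support : Set (Set X)))
    (Set.insert_subset hA ((Finsupp.mem_supported ℝ φ).1 hφ))
    (φ.support.countable_toSet.insert A) (fun _ _ => trivial)
  choose y hyℬ hy using fun l => (hB l).2.2
  choose w hw using hBne
  have hq : ∀ l, ∀ x ∈ B l, stepVal φ x = stepVal φ (w l) := fun l x hx => (hB l).1.eq hx (hw l)
  have h1 : HasSum (fun l => stepVal φ (w l) • μ (B l)) (preInt μ φ) :=
    hasSum_partition hμ hBS (fun l => ⟨w l, hw l⟩) hBd hφ (fun l => (hB l).1)
      (fun E hE x hx => hcov ⟨E, Or.inr hE, hx⟩) hq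
  have h2 : HasSum (fun l => d • {l | B l ⊆ A}.indicator (fun l => μ (B l)) l) (d • μ A) :=
    (hasSum_partition_mem hμ hBS hBd hA (fun l => (hB l).2.1)
      (fun x hx => hcov ⟨A, Or.inl rfl, hx⟩)).const_smul d
  have e1 : ∀ᶠ K in Filter.atTop, preInt μ φ - ∑ l ∈ K, stepVal φ (w l) • μ (B l) ∈ U := by
    have := h1.const_sub (preInt μ φ)
    rw [sub_self] at this
    exact this.eventually_mem hU
  have e2 : ∀ᶠ K in Filter.atTop,
      ∑ l ∈ K, d • {l | B l ⊆ A}.indicator (fun l => μ (B l)) l - d • μ A ∈ U := by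
    have := h2.sub_const (d • μ A)
    rw [sub_self] at this
    exact this.eventually_mem hU
  obtain ⟨K, hK1, hK2⟩ := (e1.and e2).exists
  have hI := hsub (preInt_mem_bilinearSum (μ := μ)
    (Submodule.add_mem _ hφ (sum_single_mem_supported (J := K) (fun l _ => hBS l)
      fun l => y l - stepVal φ (w l)))
    (approximates_modify (fun i _ j _ hij => hBd hij) (fun l _ => hq l) (fun l _ => hyℬ l)
      fun x _ => hφℬ x))
  obtain ⟨a', ha', u, hu, hau⟩ := hI
  rw [show a' = a from ha', map_add, preInt_sum_single] at hau
  refine ⟨∑ l ∈ K with B l ⊆ A, (d - y l) • μ (B l), ⟨Λ, _, B, y, fun l _ => hBS l,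
    fun l hl => (Finset.mem_filter.1 hl).2, fun i _ j _ hij => hBd hij, fun l hl => ?_, rfl⟩, ?_⟩
  · rcases hy l with h | h
    · exact h.2
    · exact absurd ((Finset.mem_filter.1 hl).2 (hw l)) (Set.disjoint_left.1 h.1 (hw l))
  · have := hUC _ hK2 u hu _ hK1
    refine hCT ?_
    convert this using 1
    have hau' : u = preInt μ φ + ∑ l ∈ K, (y l - stepVal φ (w l)) • μ (B l) - a := by
      rw [← hau]; simp
    rw [hau', Finset.sum_filter]
    have key : ∀ l ∈ K, (if B l ⊆ A then (d - y l) • μ (B l) else 0) =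
        d • {l | B l ⊆ A}.indicator (fun l => μ (B l)) l
          - (y l - stepVal φ (w l)) • μ (B l) - stepVal φ (w l) • μ (B l) := by
      intro l _
      by_cases h : B l ⊆ A
      · rw [if_pos h, Set.indicator_of_mem (show l ∈ {l | B l ⊆ A} from h)]
        module
      · have hy0 : y l = 0 := by
          rcases hy l with h' | h'
          · exact absurd h'.1 h
          · exact h'.2
        rw [if_neg h, Set.indicator_of_notMem (show l ∉ {l | B l ⊆ A} from h), hy0]
        module
    rw [Finset.sum_congr rfl key, Finset.sum_sub_distrib, Finset.sum_sub_distrib]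
    abel

end LocalIntegral

/-! ### Single levels and comparison with the semivariation of f -/

section Levels

variable {X : Type*} {S : Set (Set X)} {W : Type*} [AddCommGroup W] [Module ℝ W]
  [UniformSpace W] [IsUniformAddGroup W] [CompleteSpace W] [ContinuousSMul ℝ W]

/-- A partition into pieces on which two step-functions are constant. -/
theorem exists_level (hS : IsIntervalSystem S) {μ : Set X → W} (hμ : IsMeasureOn S μ)
    {φ ψ : Set X →₀ ℝ} (hφ : φ ∈ Finsupp.supported ℝ ℝ S) (hψ : ψ ∈ Finsupp.supported ℝ ℝ S) :
    ∃ (Λ : Type) (_ : Countable Λ) (B : Λ → Set X) (p q : Λ → ℝ), (∀ l, B l ∈ S) ∧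
      (∀ l, (B l).Nonempty) ∧ Pairwise (fun k l => Disjoint (B k) (B l)) ∧ (∀ l, ∀ x ∈ B l, stepVal φ x = p l) ∧
      (∀ l, ∀ x ∈ B l, stepVal ψ x = q l) ∧
      (∀ x, (∀ l, x ∉ B l) → stepVal φ x - stepVal ψ x = 0) ∧
      ∀ T ∈ 𝓝 (0 : W), ∃ K : Finset Λ, SvSums S μ (fun l => p l - q l) B (fun l => l ∉ K) T := by
  classical
  have hloc : Loc S (fun (_ : Unit) _ => True) (fun _ G => Resolves φ G ∧ Resolves ψ G) :=
    (Loc.and hS (loc_resolves hS hφ) (loc_resolves hS hψ)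
      (fun _ _ _ hH h => Resolves.anti hH h) fun _ _ _ hH h => Resolves.anti hH h).mono
      (fun _ _ _ => ⟨trivial, trivial⟩) fun _ _ _ _ _ h => h
  obtain ⟨Λ, hΛ, B, hBS, hBne, hBd, hcov, hB⟩ := hloc.exists_partition hS
    (Q := fun G => Resolves φ G ∧ Resolves ψ G) (fun G H hH h => ⟨h.1.anti hH, h.2.anti hH⟩)
    (𝒱 := (φ.support ∪ ψ.support : Finset (Set X))) (by
      rw [Finset.coe_union]
      exact Set.union_subset ((Finsupp.mem_supported ℝ φ).1 hφ) ((Finsupp.mem_supported ℝ ψ).1 hψ))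
    (Finset.countable_toSet _) (fun _ _ => trivial)
  choose w hw using hBne
  have hp : ∀ l, ∀ x ∈ B l, stepVal φ x = stepVal φ (w l) := fun l x hx => (hB l).1.eq hx (hw l)
  have hq : ∀ l, ∀ x ∈ B l, stepVal ψ x = stepVal ψ (w l) := fun l x hx => (hB l).2.eq hx (hw l)
  have hsupp : ∀ E ∈ (φ - ψ).support, E ∈ φ.support ∪ ψ.support := fun E hE =>
    Finsupp.support_sub hE
  refine ⟨Λ, hΛ, B, _, _, hBS, fun l => ⟨w l, hw l⟩, hBd, hp, hq, fun x hx => ?_, fun T hT => ?_⟩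
  · rw [← Pi.sub_apply, ← map_sub]
    refine stepVal_eq_zero fun E hE hxE => ?_
    obtain ⟨l, hl⟩ := Set.mem_iUnion.1 (hcov ⟨E, hsupp E hE, hxE⟩)
    exact hx l hl
  · refine exists_svSums_tail hS hμ hBS (fun l => ⟨w l, hw l⟩) hBd (Submodule.sub_mem _ hφ hψ)
      (fun l E hE => (Finset.mem_union.1 (hsupp E hE)).elim ((hB l).1 E) ((hB l).2 E))
      (fun E hE x hx => hcov ⟨E, hsupp E hE, hx⟩) (fun l x hx => ?_) hT
    rw [map_sub, Pi.sub_apply, hp l x hx, hq l x hx]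

variable [LocallyConvexSpace ℝ W]

/-- The semivariations of the pieces of a step-function near `f` are near that of `f`. -/
theorem svSums_svar_add [FirstCountableTopology W] (hS : IsIntervalSystem S) {μ : Set X → W}
    (hμ : IsMeasureOn S μ) {f : X → ℝ} (hf : Approximable S μ f) {𝒜 : Set (ℝ × X)}
    (h𝒜 : IsGen S 𝒜) (hf𝒜 : Approximates 𝒜 f) {U : Set W} (hU : IsClosed U)
    (hsm : Small S μ 𝒜 U) {Λ : Type} {B : Λ → Set X}
    (hBd : Pairwise fun k l => Disjoint (B k) (B l)) {p : Λ → ℝ}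
    (hp : ∀ l, p l ∈ fiberOn 𝒜 (B l)) :
    SvSums S μ p B (fun _ => True) (svar S μ f + U) := by
  refine svSums_of_family hBd fun ι J A l hA hAd hAB _ => ?_
  have hint : ∀ i, ∃ a, i ∈ J → HasIntegral S μ ((A i).indicator f) a := by
    intro i
    by_cases hi : i ∈ J
    · obtain ⟨a, ha⟩ := (hf.indicator hS hμ (hA i hi)).isIntegrable hS hμ
      exact ⟨a, fun _ => ha⟩
    · exact ⟨0, fun h => absurd h hi⟩
  choose a ha using hint
  refine ⟨∑ i ∈ J, a i, ?_, ∑ i ∈ J, (p (l i) • μ (A i) - a i), ?_, ?_⟩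
  · let e := J.equivFin
    refine subset_closure ⟨_, fun j => A (e.symm j), fun j => a (e.symm j),
      fun j => hA _ (e.symm j).2,
      fun i j hij => hAd (e.symm i).2 (e.symm j).2
        fun h => hij (e.symm.injective (Subtype.ext h)), fun j => ha _ (e.symm j).2, ?_⟩
    rw [e.symm.sum_comp fun i : J => a i, Finset.sum_coe_sort J fun i => a i]
  · refine sum_mem_of_forall_mem_closure (V := fun i => diffSums S μ 𝒜 (A i) (p (l i))) hU ?_
      fun i hi => smul_sub_integral_mem_closure hS hμ (hA i hi) (ha i hi) h𝒜 hf𝒜 _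
    intro v hv
    choose κ I G y hG hGA hGd hy hvs using fun i : J => hv i i.2
    -- The approximations over all A i are pooled into one disjoint family, so `Small` bounds the
    -- total error at once, independently of the size of J.
    have := hsm (Σ i : J, κ i) (Finset.univ.sigma I) (fun q => G q.1 q.2) (fun q => p (l q.1))
      (fun q => y q.1 q.2) (fun q hq => hG _ _ (Finset.mem_sigma.1 hq).2) ?_
      (fun q hq => fiberOn_anti ((hGA _ _ (Finset.mem_sigma.1 hq).2).trans (hAB _ q.1.2)) (hp _))
      (fun q hq => hy _ _ (Finset.mem_sigma.1 hq).2)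
    · rw [Finset.sum_sigma] at this
      rw [← Finset.sum_coe_sort J v]
      convert this using 2 with i
      exact hvs i
    · rintro ⟨i, s⟩ hs ⟨j, t⟩ ht hne
      have hs' := (Finset.mem_sigma.1 hs).2
      have ht' := (Finset.mem_sigma.1 ht).2
      by_cases hij : i = j
      · subst hij
        exact hGd i hs' ht' fun h : s = t => hne (by rw [h])
      · exact (hAd i.2 j.2 fun h => hij (Subtype.ext h)).mono (hGA i s hs') (hGA j t ht')
  · simp

end Levels

/-! ### Pointwise summation -/

section Pointwise

theorem hasSum_indicator_of_disjoint {X : Type*} {Λ : Type*} {B : Λ → Set X}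
    (hd : Pairwise fun k l => Disjoint (B k) (B l)) {d : Λ → ℝ} {x : X} {y : ℝ}
    (h : ∀ l, x ∈ B l → d l = y) (h0 : (∀ l, x ∉ B l) → y = 0) :
    HasSum (fun l => (B l).indicator (fun _ => d l) x) y := by
  by_cases hx : ∃ l, x ∈ B l
  · obtain ⟨l, hl⟩ := hx
    have := hasSum_single (f := fun l => (B l).indicator (fun _ => d l) x) l fun k hk =>
      Set.indicator_of_notMem (fun hxk => Set.disjoint_left.1 (hd hk) hxk hl) _
    simpa [hl, h l hl] using this
  · push Not at hx
    rw [h0 hx]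
    simp [hx]

theorem hasSum_sigma_of_abs {Λ : ℕ → Type*} {g : (Σ n, Λ n) → ℝ} {a : ℕ → ℝ} {s : ℝ}
    (h : ∀ n, HasSum (fun l => g ⟨n, l⟩) (a n))
    (habs : ∀ n, HasSum (fun l => |g ⟨n, l⟩|) |a n|) (hs : Summable fun n => |a n|)
    (ha : HasSum a s) : HasSum g s := by
  refine ha.sigma_of_hasSum h (summable_abs_iff.1 ?_)
  refine (summable_sigma_of_nonneg fun _ => abs_nonneg _).2 ⟨fun n => (habs n).summable, ?_⟩
  simpa only [(habs _).tsum_eq] using hs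

end Pointwise

theorem zero_mem_svar {X : Type*} {S : Set (Set X)} {W : Type*} [AddCommGroup W] [Module ℝ W]
    [TopologicalSpace W] (μ : Set X → W) (f : X → ℝ) : (0 : W) ∈ svar S μ f :=
  subset_closure ⟨0, fun _ => ∅, fun _ => 0, fun j => j.elim0, fun j => j.elim0,
    fun j => j.elim0, by simp⟩

/-- Sums in `A + U` for a suitable `U` have closure in `A + T`. -/
theorem exists_nhd_closure_add_subset {W : Type*} [AddCommGroup W] [Module ℝ W]
    [TopologicalSpace W] [IsTopologicalAddGroup W] [ContinuousSMul ℝ W] [LocallyConvexSpace ℝ W]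
    {T : Set W} (hT : T ∈ 𝓝 (0 : W)) :
    ∃ U ∈ 𝓝 (0 : W), ∀ A : Set W, closure (A + U) ⊆ A + T := by
  obtain ⟨U, hU, -, -, hneg, -, hUT⟩ := exists_closed_convex_nhd hT
  refine ⟨U, hU, fun A x hx => ?_⟩
  have hn : (fun y => y - x) ⁻¹' U ∈ 𝓝 x :=
    (continuous_sub_right x).continuousAt.preimage_mem_nhds (by simpa using hU)
  obtain ⟨y, hy, a, ha, u, hu, rfl⟩ := mem_closure_iff_nhds.1 hx _ hn
  refine ⟨a, ha, x - a, ?_, by simp⟩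
  have := hUT u hu _ (hneg _ hy)
  convert this using 1
  change x - a = u + -(a + u - x)
  abel

/-! ### The telescoping series -/

section Series

variable {X : Type*} {S : Set (Set X)} {W : Type*} [AddCommGroup W] [Module ℝ W]
  [UniformSpace W] [IsUniformAddGroup W] [CompleteSpace W] [ContinuousSMul ℝ W]
  [LocallyConvexSpace ℝ W] [FirstCountableTopology W]

theorem exists_series (hS : IsIntervalSystem S) {μ : Set X → W} (hμ : IsMeasureOn S μ)
    {f : X → ℝ} (hf : IsIntegrable S μ f) {T : Set W} (hT : T ∈ 𝓝 (0 : W)) :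
    ∃ (Λ : Type) (_ : Countable Λ) (c : Λ → ℝ) (E : Λ → Set X), (∀ l, E l ∈ S) ∧
      (∃ N : Set X, IsNegligible S μ N ∧ ∀ x ∉ N, SumsTo c E f x) ∧
      SvSums S μ c E (fun _ => True) (svar S μ f + T) ∧
      ∀ T' ∈ 𝓝 (0 : W), ∃ Ξ : Finset Λ, SvSums S μ c E (fun l => l ∉ Ξ) T' := by
  classical
  have hfa := hf.approximable hS hμ
  obtain ⟨τ, hτ, hτT⟩ := exists_nhdChain hT
  -- The offset 2 puts level n + 1, which belongs to 𝒜 n, into τ ((n + 1) + 1), as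
  -- `exists_svSums_tail_sigma` requires.
  obtain ⟨𝒜, φ, h⟩ := hfa.exists_envChain hS hμ (τ := fun n => τ (n + 2)) fun n => hτ.mem_nhds _
  -- Prepending the zero step-function makes φ 0 itself the increment of level 0.
  let t : ℕ → Set X →₀ ℝ := fun n => Nat.rec 0 (fun k _ => φ k) n
  have ht : ∀ n, t n ∈ Finsupp.supported ℝ ℝ S := by
    rintro (_ | n)
    · exact Submodule.zero_mem _
    · exact h.supported n
  choose Λ hΛ B p q hBS hBne hBd hp hq hoff htail using fun n =>
    exists_level hS hμ (ht (n + 1)) (ht n)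
  have hlev : ∀ n, SvSums S μ (fun l => p (n + 1) l - q (n + 1) l) (B (n + 1)) (fun _ => True)
      (τ (n + 2)) := fun n => (h.small n).svSums (hBd _)
    (fun l x hx => hp (n + 1) l x hx ▸ h.succ_mem n x)
    (fun l x hx => hq (n + 1) l x hx ▸ h.step_mem n x)
  have hlev0 : SvSums S μ (fun l => p 0 l - q 0 l) (B 0) (fun _ => True) (svar S μ f + τ 2) := by
    have hq0 : ∀ l, q 0 l = 0 := fun l => by
      obtain ⟨x, hx⟩ := hBne 0 l
      rw [← hq 0 l x hx]
      simp [t]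
    simp only [hq0, sub_zero]
    exact svSums_svar_add hS hμ hfa (h.isGen 0) (h.mem 0) (hτ.isClosed _) (h.small 0) (hBd 0)
      fun l x hx => hp 0 l x hx ▸ h.step_mem 0 x
  -- Off the exceptional set, the first summability gives absolute convergence of the double series,
  -- and the second identifies its sum as f.
  refine ⟨Σ n, Λ n, inferInstance, fun l => p l.1 l.2 - q l.1 l.2, fun l => B l.1 l.2,
    fun l => hBS l.1 l.2, ⟨{x | ¬ ((Summable fun n => |stepVal (φ (n + 1)) x - stepVal (φ n) x|) ∧
      Summable fun n => |stepVal (φ n) x - f x|)}, ?_, ?_⟩, ?_, ?_⟩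
  · refine isNegligible_of_not_summable hS hμ hτ h.isGen
      (fun n => (h.small n).mono (hτ.antitone (Nat.le_succ _))) fun x hx => ?_
    by_cases h1 : Summable fun n => |stepVal (φ (n + 1)) x - stepVal (φ n) x|
    · exact ⟨fun n => stepVal (φ n) x, fun _ => f x, fun n => ⟨h.step_mem n x, h.mem n x⟩,
        fun h2 => hx ⟨h1, h2⟩⟩
    · exact ⟨fun n => stepVal (φ (n + 1)) x, fun n => stepVal (φ n) x,
        fun n => ⟨h.succ_mem n x, h.step_mem n x⟩, h1⟩
  · intro x hx
    obtain ⟨h1, h2⟩ := not_not.1 hx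
    have hsum : Summable fun n => |stepVal (t (n + 1)) x - stepVal (t n) x| :=
      (summable_nat_add_iff 1).1 h1
    refine hasSum_sigma_of_abs (a := fun n => stepVal (t (n + 1)) x - stepVal (t n) x)
      (fun n => ?_) (fun n => ?_) hsum ?_
    · exact hasSum_indicator_of_disjoint (hBd n)
        (fun l hl => by rw [hp n l x hl, hq n l x hl]) (hoff n x)
    · have := hasSum_indicator_of_disjoint (hBd n) (d := fun l => |p n l - q n l|) (x := x)
        (y := |stepVal (t (n + 1)) x - stepVal (t n) x|)
        (fun l hl => by rw [hp n l x hl, hq n l x hl]) (fun hx => by rw [hoff n x hx, abs_zero])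
      convert this using 2 with l
      by_cases hl : x ∈ B n l <;> simp [hl]
    · rw [(summable_abs_iff.1 hsum).hasSum_iff_tendsto_nat]
      simp only [Finset.sum_range_sub (fun n => stepVal (t n) x)]
      rw [← Filter.tendsto_add_atTop_iff_nat 1]
      have h3 : Filter.Tendsto (fun n => stepVal (φ n) x - f x) Filter.atTop (𝓝 0) :=
        (tendsto_zero_iff_abs_tendsto_zero _).2 h2.tendsto_atTop_zero
      have h4 := h3.add_const (f x)
      simp only [sub_add_cancel, zero_add] at h4
      simpa [t] using h4
  · intro L v _ hv
    have hlevZ : ∀ n, SvSums S μ (fun l => p n l - q n l) (B n) (fun _ => True)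
        (if n = 0 then svar S μ f + τ 2 else τ (n + 1)) := by
      rintro (_ | n)
      · simpa using hlev0
      · simpa using hlev n
    obtain ⟨F, z, hz, hsum⟩ := SvSums.exists_sigma (p := fun _ => True) hlevZ
      (fun _ _ => trivial) hv
    -- The levels above 0 use up one copy of τ 1; the other is left for the deviation of level 0
    -- from the semivariation of f.
    have h1 : ∑ n ∈ F.erase 0, z n ∈ τ 1 := hτ.sum_mem _
      (fun n hn => Nat.one_le_iff_ne_zero.2 (Finset.mem_erase.1 hn).1)
      fun n hn => by simpa [(Finset.mem_erase.1 hn).1] using hz n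
    have h0 : ∃ s ∈ svar S μ f, ∃ u ∈ τ 1, ∑ n ∈ F, z n = s + u + ∑ n ∈ F.erase 0, z n := by
      by_cases h0 : 0 ∈ F
      · obtain ⟨s, hs, u, hu, hsu⟩ : z 0 ∈ svar S μ f + τ 2 := by simpa using hz 0
        refine ⟨s, hs, u, hτ.antitone (by norm_num) hu, ?_⟩
        rw [← Finset.add_sum_erase F z h0, ← hsu]
      · exact ⟨0, zero_mem_svar μ f, 0, hτ.zero_mem 1, by simp [h0]⟩
    obtain ⟨s, hs, u, hu, hsu⟩ := h0
    rw [hsum, hsu]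
    exact ⟨s, hs, u + ∑ n ∈ F.erase 0, z n, hτT (hτ.add 0 u hu _ h1), (add_assoc _ _ _).symm⟩
  · intro T' hT'
    refine exists_svSums_tail_sigma hτ (c := fun n l => p n l - q n l) (E := B) ?_ htail hT'
    rintro (_ | n) hn
    · exact absurd hn (lt_irrefl 0)
    · exact hlev n

end Series

/-! ### Joining families -/

section SumTypes

variable {X : Type*} {S : Set (Set X)} {W : Type*} [AddCommGroup W] [Module ℝ W] {μ : Set X → W}

theorem SvSums.exists_add {Λ₁ Λ₂ : Type*} {c : Λ₁ ⊕ Λ₂ → ℝ} {E : Λ₁ ⊕ Λ₂ → Set X}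
    {p : Λ₁ ⊕ Λ₂ → Prop} {U₁ U₂ : Set W}
    (h₁ : SvSums S μ (fun l => c (Sum.inl l)) (fun l => E (Sum.inl l)) (fun l => p (Sum.inl l)) U₁)
    (h₂ : SvSums S μ (fun l => c (Sum.inr l)) (fun l => E (Sum.inr l)) (fun l => p (Sum.inr l)) U₂) :
    SvSums S μ c E p (U₁ + U₂) := by
  intro L v hp hv
  rw [← Finset.toLeft_disjSum_toRight (u := L), Finset.sum_disjSum]
  exact Set.add_mem_add
    (h₁ _ _ (fun l hl => hp _ (Finset.mem_toLeft.1 hl)) fun l hl => hv _ (Finset.mem_toLeft.1 hl))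
    (h₂ _ _ (fun l hl => hp _ (Finset.mem_toRight.1 hl))
      fun l hl => hv _ (Finset.mem_toRight.1 hl))

theorem SvSums.neg {Λ : Type*} {c : Λ → ℝ} {E : Λ → Set X} {p : Λ → Prop} {U : Set W}
    (h : SvSums S μ c E p U) : SvSums S μ (fun l => -c l) E p (-U) := by
  intro L v hp hv
  have := h L (fun l => -v l) hp fun l hl => by
    obtain ⟨n, A, hA, hAE, hd, hs⟩ := hv l hl
    exact ⟨n, A, hA, hAE, hd, by simp [hs]⟩
  rw [Finset.sum_neg_distrib] at this
  exact Set.mem_neg.2 this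

theorem exists_svSums_tail_sum [TopologicalSpace W] [IsTopologicalAddGroup W] {Λ₁ Λ₂ : Type*}
    {c : Λ₁ ⊕ Λ₂ → ℝ} {E : Λ₁ ⊕ Λ₂ → Set X}
    (h₁ : ∀ T ∈ 𝓝 (0 : W), ∃ Ξ : Finset Λ₁,
      SvSums S μ (fun l => c (Sum.inl l)) (fun l => E (Sum.inl l)) (fun l => l ∉ Ξ) T)
    (h₂ : ∀ T ∈ 𝓝 (0 : W), ∃ Ξ : Finset Λ₂,
      SvSums S μ (fun l => c (Sum.inr l)) (fun l => E (Sum.inr l)) (fun l => l ∉ Ξ) T)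
    {T : Set W} (hT : T ∈ 𝓝 (0 : W)) :
    ∃ Ξ : Finset (Λ₁ ⊕ Λ₂), SvSums S μ c E (fun l => l ∉ Ξ) T := by
  obtain ⟨U, hU, hUT⟩ := exists_nhds_zero_half hT
  obtain ⟨Ξ₁, hΞ₁⟩ := h₁ U hU
  obtain ⟨Ξ₂, hΞ₂⟩ := h₂ U hU
  refine ⟨Ξ₁.disjSum Ξ₂, fun L v hp hv => ?_⟩
  obtain ⟨a, ha, b, hb, hab⟩ := SvSums.exists_add (p := fun l => l ∉ Ξ₁.disjSum Ξ₂)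
    (U₁ := U) (U₂ := U) (by simpa using hΞ₁) (by simpa using hΞ₂) L v hp hv
  exact hab ▸ hUT a ha b hb

end SumTypes

/-! ### Real measures and complete divergence -/

section Real

variable {X : Type*} {S : Set (Set X)} {μ : Set X → ℝ}

theorem summable_of_sum_mem_Ioo {Λ : Type*} {v : Λ → ℝ}
    (h : ∀ L : Finset Λ, ∑ l ∈ L, v l ∈ Set.Ioo (-1 : ℝ) 1) : Summable v := by
  classical
  refine summable_abs_iff.1 (summable_of_sum_le (c := 2) (fun _ => abs_nonneg _) fun L => ?_)
  have h1 := (h (L.filter fun l => 0 ≤ v l)).2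
  have h2 := (h (L.filter fun l => ¬ 0 ≤ v l)).1
  rw [← Finset.sum_filter_add_sum_filter_not L (fun l => 0 ≤ v l),
    Finset.sum_congr rfl fun l hl => abs_of_nonneg (Finset.mem_filter.1 hl).2,
    Finset.sum_congr (s₁ := L.filter fun l => ¬ 0 ≤ v l) rfl
      fun l hl => abs_of_neg (not_le.1 (Finset.mem_filter.1 hl).2), Finset.sum_neg_distrib]
  linarith

/-- Bounded finite sums of reals force summability, so `exists_uniform_tail` applies even when the
sets do not come from the partition of a step-function. -/
theorem SvSums.exists_tail_of_real {Λ : Type*} {c : Λ → ℝ} {E : Λ → Set X}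
    (h : SvSums S μ c E (fun _ => True) (Set.Ioo (-1) 1)) {T : Set ℝ} (hT : T ∈ 𝓝 (0 : ℝ)) :
    ∃ K : Finset Λ, SvSums S μ c E (fun l => l ∉ K) T :=
  exists_uniform_tail (fun l => zero_mem_svarPre μ (c l) (E l))
    (fun v hv => summable_of_sum_mem_Ioo fun L => h L v (fun _ _ => trivial) fun l _ => hv l) hT

/-- A negligible set is covered infinitely often by sets of small total semivariation. -/
theorem IsNegligible.exists_cover (hS : IsIntervalSystem S) (hμ : IsMeasureOn S μ) {N : Set X}
    (hN : IsNegligible S μ N) {V : Set ℝ} (hV : V ∈ 𝓝 (0 : ℝ)) :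
    ∃ (Λ : Type) (_ : Countable Λ) (E : Λ → Set X), (∀ l, E l ∈ S) ∧
      SvSums S μ (fun _ => 1) E (fun _ => True) V ∧
      (∀ T ∈ 𝓝 (0 : ℝ), ∃ Ξ : Finset Λ, SvSums S μ (fun _ => 1) E (fun l => l ∉ Ξ) T) ∧
      IsNegligible S μ {x | ¬ Summable fun l => (E l).indicator (fun _ => (1 : ℝ)) x} ∧
      ∀ x ∈ N, ¬ Summable fun l => (E l).indicator (fun _ => (1 : ℝ)) x := by
  classical
  obtain ⟨τ, hτ, hτV⟩ := exists_nhdChain (Filter.inter_mem hV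
    (Ioo_mem_nhds (neg_lt_zero.2 one_pos) one_pos : Set.Ioo (-1 : ℝ) 1 ∈ 𝓝 0))
  -- The index m + 2 leaves one step for passing to differences of pre-integrals.
  choose 𝒞 hpt hsub hbil using fun m => hN _ (hτ.mem_nhds (m + 2))
  have hgen : ∀ m, IsGen S (𝒞 m) := fun m => (hpt m).1.isGen hS
  have hsm : ∀ m, Small S μ (𝒞 m) (τ (m + 1)) := by
    intro m
    obtain ⟨φ, hφ, hφ𝒞⟩ := (hpt m).1.exists_step
    exact small_of_bilinearSum hS hμ hφ hφ𝒞 (hbil m) (hτ.isClosed _)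
      fun u hu v hv => hτ.sub hu hv
  choose 𝒟 h𝒟S h𝒟 h𝒟gen using fun m => (hpt m).1.2
  -- The generating sets admitting the value 1 cover N at every level m. Comparing 1 with the value
  -- 0 of the pointed envelope bounds their semivariations.
  choose Λ hΛ B hBS hBne hBd hBU hBD using fun m =>
    exists_disjoint_refinement hS (C := {D ∈ 𝒟 m | (1 : ℝ) ∈ fiberOn (𝒞 m) D})
      (fun D hD => h𝒟S m hD.1) ((h𝒟 m).mono fun D hD => hD.1)
  have h1B : ∀ m l, (1 : ℝ) ∈ fiberOn (𝒞 m) (B m l) := fun m l => by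
    obtain ⟨D, hD, hBD⟩ := hBD m l
    exact fiberOn_anti hBD hD.2
  have hcov : ∀ m, ∀ x ∈ N, ∃ l, x ∈ B m l := by
    intro m x hx
    have h1 : ((1 : ℝ), x) ∈ 𝒞 m := hsub m ⟨trivial, hx⟩
    have h2 := h1
    rw [h𝒟gen m] at h2
    rcases h2 with h2 | h2
    · simp only [Set.mem_iUnion] at h2
      obtain ⟨D, hD, h1D, hxD⟩ := h2
      have : x ∈ ⋃ l, B m l := by
        rw [hBU m]
        exact ⟨D, ⟨hD, h1D⟩, hxD⟩
      exact Set.mem_iUnion.1 this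
    · exact absurd h2.1 one_ne_zero
  have hlev : ∀ m, SvSums S μ (fun _ => 1) (B m) (fun _ => True) (τ (m + 1)) := fun m => by
    simpa using (hsm m).svSums (hBd m) (p := fun _ => 1) (q := fun _ => 0) (h1B m)
      fun l x _ => (hpt m).2 x
  let g : ℕ → X → ℝ := fun m x => if ∃ l, x ∈ B m l then 1 else 0
  have hg : ∀ m x, HasSum (fun l => (B m l).indicator (fun _ => (1 : ℝ)) x) (g m x) :=
    fun m x => hasSum_indicator_of_disjoint (hBd m)
      (fun l hl => by simp only [g]; rw [if_pos ⟨l, hl⟩])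
      fun h => if_neg fun ⟨l, hl⟩ => h l hl
  have hg0 : ∀ m x, 0 ≤ g m x := fun m x => by
    simp only [g]; split_ifs <;> norm_num
  have hiff : ∀ x, (Summable fun l : Σ m, Λ m => (B l.1 l.2).indicator (fun _ => (1 : ℝ)) x) ↔
      Summable fun m => g m x := by
    intro x
    rw [summable_sigma_of_nonneg fun l => Set.indicator_nonneg (fun _ _ => zero_le_one) x]
    simp only [(hg _ x).tsum_eq]
    exact ⟨fun h => h.2, fun h => ⟨fun m => (hg m x).summable, h⟩⟩
  refine ⟨Σ m, Λ m, inferInstance, fun l => B l.1 l.2, fun l => hBS l.1 l.2, ?_, ?_, ?_, ?_⟩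
  · intro L v _ hv
    obtain ⟨F, z, hz, hsum⟩ := SvSums.exists_sigma (p := fun _ => True) hlev
      (fun _ _ => trivial) hv
    rw [hsum]
    exact (hτV (hτ.sum_mem F (fun n _ => Nat.zero_le n) fun n _ => hz n)).1
  · intro T hT
    refine exists_svSums_tail_sigma hτ (c := fun _ _ => 1) (E := B) (fun m _ => hlev m)
      (fun m T' hT' => SvSums.exists_tail_of_real (fun L v hp hv => ?_) hT') hT
    exact (hτV (hτ.antitone (Nat.zero_le _) (hlev m L v hp hv))).2
  · refine isNegligible_of_not_summable hS hμ hτ hgen hsm fun x hx => ?_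
    refine ⟨fun m => g m x, fun _ => 0, fun m => ⟨?_, (hpt m).2 x⟩, fun h => hx ((hiff x).2 ?_)⟩
    · by_cases h : ∃ l, x ∈ B m l
      · simp only [g, if_pos h]
        obtain ⟨l, hl⟩ := h
        exact h1B m l x hl
      · simp only [g, if_neg h]
        exact (hpt m).2 x
    · simpa [abs_of_nonneg (hg0 _ x)] using h
  · intro x hx h
    have h1 := (hiff x).1 h
    simp only [g, if_pos (hcov _ x hx)] at h1
    exact one_ne_zero ((summable_const_iff (1 : ℝ)).1 h1)

/-- To the series of `exists_series`, each set of an infinite cover of its exceptional set is added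
with coefficients 1 and -1. Points covered finitely often lie outside the exceptional set, and there
the new terms cancel; at all other points the positive and the negative parts are both infinite. -/
theorem exists_series_real (hS : IsIntervalSystem S) (hμ : IsMeasureOn S μ)
    {f : X → ℝ} (hf : IsIntegrable S μ f) {ε : ℝ} (hε : 0 < ε) :
    ∃ (Λ : Type) (_ : Countable Λ) (c : Λ → ℝ) (E : Λ → Set X),
      (∀ l, E l ∈ S) ∧
      (∃ N : Set X, IsNegligible S μ N ∧ ∀ x ∉ N, SumsTo c E f x) ∧
      (∀ x, SumsTo c E f x ∨ CompletelyDivergent c E x) ∧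
      SumSvarIn S μ c E (svar S μ f + Set.Ioo (-ε) ε) ∧
      SvarTailsSmall S μ c E := by
  obtain ⟨U, hU, hcl⟩ := exists_nhd_closure_add_subset
    (Ioo_mem_nhds (neg_lt_zero.2 hε) hε : Set.Ioo (-ε) ε ∈ 𝓝 0)
  obtain ⟨V, hV, C, hCU, -, hVC⟩ := exists_closed_nhd_sub_add hU
  obtain ⟨Λ, hΛ, c, E, hE, ⟨N, hN, hsum⟩, hsv, htail⟩ := exists_series hS hμ hf hV
  obtain ⟨Λ', hΛ', B, hB, hBsv, hBtail, hN', hNN'⟩ := hN.exists_cover hS hμ hV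
  let c' : Λ ⊕ (Λ' ⊕ Λ') → ℝ := Sum.elim c (Sum.elim (fun _ => 1) fun _ => -1)
  let E' : Λ ⊕ (Λ' ⊕ Λ') → Set X := Sum.elim E (Sum.elim B B)
  have hsums : ∀ x, (Summable fun l => (B l).indicator (fun _ => (1 : ℝ)) x) →
      SumsTo c' E' f x := by
    intro x hx
    have h1 := hsum x fun hxN => hNN' x hxN hx
    have h2 := hx.hasSum
    have h2' : HasSum (fun l => (B l).indicator (fun _ => (-1 : ℝ)) x)
        (-∑' l, (B l).indicator (fun _ => (1 : ℝ)) x) := by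
      have e : (fun l => (B l).indicator (fun _ => (-1 : ℝ)) x) =
          fun l => -(B l).indicator (fun _ => (1 : ℝ)) x := by
        ext l
        by_cases hl : x ∈ B l <;> simp [hl]
      rw [e]
      exact h2.neg
    have h3 := h1.sum (f := fun l => (E' l).indicator (fun _ => c' l) x)
      (HasSum.sum (f := fun l => (E' (Sum.inr l)).indicator (fun _ => c' (Sum.inr l)) x) h2 h2')
    rw [add_neg_cancel, add_zero] at h3
    exact h3
  refine ⟨Λ ⊕ (Λ' ⊕ Λ'), inferInstance, c', E', ?_, ⟨_, hN', fun x hx => hsums x (not_not.1 hx)⟩,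
    fun x => ?_, ?_, ?_⟩
  · rintro (l | l | l)
    exacts [hE l, hB l, hB l]
  · by_cases hx : Summable fun l => (B l).indicator (fun _ => (1 : ℝ)) x
    · exact Or.inl (hsums x hx)
    · refine Or.inr ⟨fun h => hx ?_, fun h => hx ?_⟩
      · refine (h.comp_injective (Sum.inr_injective.comp Sum.inl_injective)).congr fun l => ?_
        by_cases hl : x ∈ B l <;> simp [E', c', hl]
      · refine (h.comp_injective (Sum.inr_injective.comp Sum.inr_injective)).congr fun l => ?_
        by_cases hl : x ∈ B l <;> simp [E', c', hl]
  · have h : SvSums S μ c' E' (fun _ => True) (svar S μ f + V + (V + -V)) :=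
      SvSums.exists_add (p := fun _ => True) hsv
        (SvSums.exists_add (p := fun _ => True) hBsv hBsv.neg)
    have h' : SvSums S μ c' E' (fun _ => True) (closure (svar S μ f + U)) := by
      intro L v hp hv
      obtain ⟨_, ⟨s, hs, t, ht, rfl⟩, _, ⟨u, hu, w, hw, rfl⟩, hst⟩ := h L v hp hv
      rw [← hst]
      refine subset_closure ⟨s, hs, t + (u + w), ?_, by simp [add_assoc]⟩
      have := hVC t ht (-w) hw u hu
      convert hCU this using 1
      ring
    exact (h'.sumSvarIn isClosed_closure).trans (hcl _)
  · refine svarTailsSmall_of_svSums fun T hT => ?_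
    refine exists_svSums_tail_sum htail (fun T' hT' => exists_svSums_tail_sum hBtail
      (fun T'' hT'' => ?_) hT') hT
    obtain ⟨Ξ, hΞ⟩ := hBtail (-T'') (by simpa using neg_mem_nhds_zero ℝ hT'')
    have := hΞ.neg
    rw [neg_neg] at this
    exact ⟨Ξ, this⟩

end Real

end LMInt

theorem mainTheorem7 {X : Type*} (S : Set (Set X)) (hS : IsIntervalSystem S) :
    (∀ (W : Type*) [AddCommGroup W] [Module ℝ W] [UniformSpace W] [IsUniformAddGroup W]
        [ContinuousSMul ℝ W] [LocallyConvexSpace ℝ W] [FirstCountableTopology W] [T2Space W]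
        [CompleteSpace W] (μ : Set X → W), IsMeasureOn S μ →
      ∀ f : X → ℝ, IsIntegrable S μ f → ∀ T ∈ 𝓝 (0 : W),
        ∃ (Λ : Type) (_ : Countable Λ) (c : Λ → ℝ) (E : Λ → Set X),
          (∀ l, E l ∈ S) ∧
          (∃ N : Set X, IsNegligible S μ N ∧ ∀ x ∉ N, SumsTo c E f x) ∧
          SumSvarIn S μ c E (svar S μ f + T) ∧
          SvarTailsSmall S μ c E) ∧
    (∀ μ : Set X → ℝ, IsMeasureOn S μ →
      ∀ f : X → ℝ, IsIntegrable S μ f → ∀ ε : ℝ, 0 < ε →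
        ∃ (Λ : Type) (_ : Countable Λ) (c : Λ → ℝ) (E : Λ → Set X),
          (∀ l, E l ∈ S) ∧
          (∃ N : Set X, IsNegligible S μ N ∧ ∀ x ∉ N, SumsTo c E f x) ∧
          (∀ x, SumsTo c E f x ∨ CompletelyDivergent c E x) ∧
          SumSvarIn S μ c E (svar S μ f + Set.Ioo (-ε) ε) ∧
          SvarTailsSmall S μ c E) := by
  refine ⟨?_, fun μ hμ f hf ε hε => exists_series_real hS hμ hf hε⟩
  intro W _ _ _ _ _ _ _ _ _ μ hμ f hf T hT
  obtain ⟨U, hU, hcl⟩ := exists_nhd_closure_add_subset hT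
  obtain ⟨Λ, hΛ, c, E, hE, hN, hsv, htail⟩ := exists_series hS hμ hf hU
  refine ⟨Λ, hΛ, c, E, hE, hN, ?_, svarTailsSmall_of_svSums htail⟩
  have h : SvSums S μ c E (fun _ => True) (closure (svar S μ f + U)) :=
    fun L v hp hv => subset_closure (hsv L v hp hv)
  exact (h.sumSvarIn isClosed_closure).trans (hcl _)
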